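/- **Setting.** Let $(\Omega,\mathcal A,\mathbb P)$ be a probability space and $n,k,p,T,N,n_*,k_*,p_*,q_*,T_*\ge 0$ integers. Let $s_1,\dots,s_T$ be random regimes in $\{1,\dots,N\}$, $\mathsf P=(p_{ij})$ a random stochastic $N\times N$ matrix, and for each regime $j$ let $\Pi(j)=[A_0(j):A_1(j):\dots:A_p(j)]$ (with $A_0(j)\in\mathbb R^{n\times k}$, $A_i(j)\in\mathbb R^{n\times n}$) and $\Gamma(j)\in\mathbb R^{n_*\times(k_*+n_*(p_*+q_*))}$ be random matrices; put $\Pi_t:=\Pi(s_t)$, $A_{i,t}:=A_i(s_t)$, $\Gamma_t:=\Gamma(s_t)$. Write $\Pi$, $\Gamma$ for the collections $(\Pi(j))_{j\le N}$, $(\Gamma(j))_{j\le N}$ and $s=(s_1,\dots,s_T)$. Let $$y_t=\Pi_t\mathsf Y_{t-1}+\xi_t,\quad \mathsf Y_{t-1}=(\psi_t',y_{t-1}',\dots,y_{t-p}')',\quad \xi_t=\Sigma_t^{1/2}\varepsilon_t,\qquad t=1,\dots,T,$$ where $y_t\in\mathbb R^n$, $\psi_t\in\mathbb R^k$ are random vectors,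 $\Sigma_t$ is a random positive definite $n\times n$ matrix with Cholesky factor $\Sigma_t^{1/2}$, and $\varepsilon_1,\dots,\varepsilon_T$ are i.i.d. $\mathcal N(0,I_n)$. Let $\mathcal F_0$ be generated by $y_{1-p-T_*},\dots,y_0$, $\psi_{1-T_*},\dots,\psi_T$ and $\Sigma_{1-q_*},\dots,\Sigma_0$, and let $$\mathcal F_t=\mathcal F_0\vee\sigma(y_1,\dots,y_t),\qquad \mathcal H_t=\mathcal F_t\vee\sigma(\Pi)\vee\sigma(\Gamma)\vee\sigma(\mathsf P)\vee\sigma(s),$$ $$\mathcal I_{t-1}=\mathcal F_{t-1}\vee\sigma(\Pi_1,\dots,\Pi_t)\vee\sigma(\Gamma_1,\dots,\Gamma_t)\vee\sigma(\mathsf P)\vee\sigma(s_1,\dots,s_t).$$ Assume: $\Sigma_t$ is $\mathcal I_{t-1}$-measurable for $t=1,\dots,T$; $(\varepsilon_1,\dots,\varepsilon_T)$ is independent of $\mathcal F_0$ and, conditionally on $\mathcal F_0$, independent of $(\Pi,\Gamma,\mathsf P,s)$; $\mathsf P$ is independent of $(\Pi,\Gamma)$ given $\mathcal F_0$ and $s$;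 and $\mathbb P[s_{t+1}=j\mid s_1,\dots,s_t,\mathsf P,\mathcal F_0]=p_{s_tj}$ for $1\le t<T$. Let $\theta_t\in\mathbb R^n$ be $\mathcal I_{t-1}$-measurable with $$\theta_t=\Delta_{0,t}\psi_t+\Delta_{1,t}y_{t-1}+\dots+\Delta_{p,t}y_{t-p},\qquad t=1,\dots,T,$$ for $\mathcal H_t$-measurable random matrices $\Delta_{0,t}\in\mathbb R^{n\times k}$, $\Delta_{i,t}\in\mathbb R^{n\times n}$, and define the risk-neutral measure $\tilde{\mathbb P}$ by $$\frac{d\tilde{\mathbb P}}{d\mathbb P}=L_T=\prod_{m=1}^T\exp\Big\{\theta_m'\Sigma_m^{-1}\xi_m-\tfrac12\theta_m'\Sigma_m^{-1}\theta_m\Big\}.$$ Let $\Psi$ be the $nT\times nT$ matrix with $n\times n$ blocks $\Psi_{t,t}=I_n$, $\Psi_{t,t-i}=-(A_{i,t}+\Delta_{i,t})$ for $1\le i\le p$, $t-i\ge1$, and $0$ otherwise; let $\delta\in\mathbb R^{nT}$ have blocks $\delta_t=(A_{0,t}+\Delta_{0,t})\psi_t+\sum_{1\le i\le p,\ t-i\le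 0}(A_{i,t}+\Delta_{i,t})y_{t-i}$; let $\Sigma=\mathrm{diag}\{\Sigma_1,\dots,\Sigma_T\}$ and $y=(y_1',\dots,y_T')'$. For $0\le t\le T$ let $\bar y_t$, $\bar y_t^c$ be the sub-vectors of $y$ of times $\le t$ and $>t$, and let $\delta=\binom{\delta_1}{\delta_2}$, $\Psi=\begin{bmatrix}\Psi_{11}&0\\ \Psi_{21}&\Psi_{22}\end{bmatrix}$, $\Sigma=\mathrm{diag}\{\bar\Sigma_t,\bar\Sigma_t^c\}$ be the corresponding partitions, and $C_{21}=-\Psi_{22}^{-1}\Psi_{21}\Psi_{11}^{-1}$. "$X\mid\mathcal G\sim\mathcal N(a,S)$ under $\tilde{\mathbb P}$" means that $a,S$ are $\mathcal G$-measurable and $\mathcal N(a,S)$ is the conditional law of $X$ given $\mathcal G$ under $\tilde{\mathbb P}$. **Theorem.** $\tilde{\mathbb P}$ is a probability measure, and under $\tilde{\mathbb P}$: 1. $y\mid\mathcal H_0\sim\mathcal N\big(\Psi^{-1}\delta,\ \Psi^{-1}\Sigma(\Psi^{-1})'\big)$, provided $\Psi,\delta,\Sigma$ are $\mathcal H_0$-measurable;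 2. for $0\le t\le T$, $\bar y_t\mid\mathcal H_0\sim\mathcal N\big(\Psi_{11}^{-1}\delta_1,\ \Psi_{11}^{-1}\bar\Sigma_t(\Psi_{11}^{-1})'\big)$, provided $\Psi_{11},\delta_1,\bar\Sigma_t$ are $\mathcal H_0$-measurable; 3. for $0\le t\le T$, $\bar y_t^c\mid\mathcal H_0\sim\mathcal N\big(C_{21}\delta_1+\Psi_{22}^{-1}\delta_2,\ C_{21}\bar\Sigma_tC_{21}'+\Psi_{22}^{-1}\bar\Sigma_t^c(\Psi_{22}^{-1})'\big)$, provided $\Psi,\delta,\Sigma$ are $\mathcal H_0$-measurable; 4. for $0\le t\le T$, $\bar y_t^c\mid\mathcal H_t\sim\mathcal N\big(\Psi_{22}^{-1}(\delta_2-\Psi_{21}\bar y_t),\ \Psi_{22}^{-1}\bar\Sigma_t^c(\Psi_{22}^{-1})'\big)$, provided $\Psi_{21},\Psi_{22},\delta_2,\bar\Sigma_t^c$ are $\mathcal H_t$-measurable; 5. for $1\le t\le T$, $y_t\mid\mathcal H_{t-1}\sim\mathcal N\big(\Pi_t\mathsf Y_{t-1}+\theta_t,\ \Sigma_t\big)$.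 Moreover, the conditional law of $(s,\mathsf P)$ given $\mathcal F_0$ is the same under $\tilde{\mathbb P}$ and $\mathbb P$, and for every Borel set $B$, almost surely, $$\tilde{\mathbb P}\big[(\Pi,\Gamma)\in B\,\big|\,s,\mathsf P,\mathcal F_0\big]=\mathbb P\big[(\Pi,\Gamma)\in B\,\big|\,s,\mathcal F_0\big];$$ the same identity holds for the stacked matrices $[\Pi_1:\dots:\Pi_T]$, $[\Gamma_1:\dots:\Gamma_T]$ in place of $(\Pi,\Gamma)$. -/

import Mathlib

open MeasureTheory ProbabilityTheory Matrix

noncomputable section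

/-- Matrices carry the product (Borel) `σ`-algebra of their entries. -/
instance matrixMeasurableSpace {m n : Type*} : MeasurableSpace (Matrix m n ℝ) :=
  inferInstanceAs (MeasurableSpace (m → n → ℝ))

/-- The `σ`-fields `m₁` and `m₂` are conditionally independent given `m` under `μ`. -/
def CondIndepFields {Ω : Type*} {mΩ : MeasurableSpace Ω} (μ : Measure Ω)
    (m m₁ m₂ : MeasurableSpace Ω) : Prop :=
  ∀ A B : Set Ω, MeasurableSet[m₁] A → MeasurableSet[m₂] B →
    μ⟦A ∩ B | m⟧ =ᵐ[μ] μ⟦A | m⟧ * μ⟦B | m⟧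

/-- `X | 𝒢 ∼ N(a, S)` under `μ`, for a random mean vector `a` and a random covariance matrix `S`:
both are `𝒢`-measurable, and for every Borel set `B` the conditional probability of `X ∈ B`
given `𝒢` is almost surely the mass that `N(a, S)` gives to `B`. -/
def CondGaussian {Ω ι : Type*} [Fintype ι] [DecidableEq ι] {mΩ : MeasurableSpace Ω}
    (μ : Measure Ω) (𝒢 : MeasurableSpace Ω) (X : Ω → ι → ℝ) (a : Ω → ι → ℝ)
    (S : Ω → Matrix ι ι ℝ) : Prop :=
  Measurable[𝒢] a ∧ Measurable[𝒢] S ∧ (∀ ω, (S ω).PosSemidef) ∧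
    ∀ B : Set (EuclideanSpace ℝ ι), MeasurableSet B →
      μ⟦{ω | WithLp.toLp 2 (X ω) ∈ B} | 𝒢⟧ =ᵐ[μ]
        fun ω => (multivariateGaussian (WithLp.toLp 2 (a ω)) (S ω)).real B

/-- `L` is the Cholesky factor of `S`: lower triangular, with positive diagonal, `L L' = S`. -/
def IsCholeskyFactor {n : ℕ} (L S : Matrix (Fin n) (Fin n) ℝ) : Prop :=
  (∀ i j, i < j → L i j = 0) ∧ (∀ i, 0 < L i i) ∧ L * Lᵀ = S

/-- The times `a, a + 1, …, b`. -/
abbrev Times (a b : ℤ) : Type := {t : ℤ // t ∈ Finset.Icc a b}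

/-- Columns of an autoregressive coefficient matrix `[A₀ : A₁ : ⋯ : A_p]`: first the `k` columns
of `A₀`, then, for each lag `i = 1, …, p` (represented by `i - 1 : Fin p`), the `n` columns
of `A_i`. -/
abbrev Cols (k p n : ℕ) : Type := Fin k ⊕ (Fin p × Fin n)

/-- The random objects of a Bayesian Markov-switching VAR(`p`) process with `n` variables, `k`
exogenous variables, horizon `T`, `N` regimes, volatility coefficients of sizes `n'`, `k'`,
`p'`, `q'`, and data from `Tpast` periods before time 1 (`Tpast = 0`: no such data). Times are
integers; only `y_t` for `1 - p - Tpast ≤ t ≤ T`, `ψ_t` for `1 - Tpast ≤ t ≤ T`, `Σ_t` for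
`1 - q' ≤ t ≤ T`, and the other processes for `1 ≤ t ≤ T` play a role. -/
structure MSVAR (Ω : Type*) (n k p T N n' k' p' q' Tpast : ℕ) where
  /-- the process `y_t` -/
  y : ℤ → Ω → Fin n → ℝ
  /-- the exogenous variables `ψ_t` -/
  psi : ℤ → Ω → Fin k → ℝ
  /-- the covariance matrices `Σ_t` -/
  Sig : ℤ → Ω → Matrix (Fin n) (Fin n) ℝ
  /-- the Cholesky factors of the `Σ_t` -/
  chol : ℤ → Ω → Matrix (Fin n) (Fin n) ℝ
  /-- the white noise `ε_t` -/
  eps : ℤ → Ω → Fin n → ℝ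
  /-- the regimes `s_t` -/
  s : ℤ → Ω → Fin N
  /-- the random transition probability matrix -/
  trans : Ω → Matrix (Fin N) (Fin N) ℝ
  /-- the coefficient matrix `Π(j) = [A₀(j) : ⋯ : A_p(j)]` of regime `j` -/
  Pi : Fin N → Ω → Matrix (Fin n) (Cols k p n) ℝ
  /-- the coefficient matrix `Γ(j) = [B₀(j) : ⋯ : B_{p' + q'}(j)]` of regime `j` -/
  Gam : Fin N → Ω → Matrix (Fin n') (Cols k' (p' + q') n') ℝ

namespace MSVAR

variable {Ω : Type*} {n k p T N n' k' p' q' Tpast : ℕ}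
  (M : MSVAR Ω n k p T N n' k' p' q' Tpast)

/-- `Π_t = Π(s_t)`. -/
def PiAt (t : ℤ) (ω : Ω) : Matrix (Fin n) (Cols k p n) ℝ := M.Pi (M.s t ω) ω

/-- `Γ_t = Γ(s_t)`. -/
def GamAt (t : ℤ) (ω : Ω) : Matrix (Fin n') (Cols k' (p' + q') n') ℝ := M.Gam (M.s t ω) ω

/-- `lagged t` is the vector `Y_{t-1} = (ψ_t', y_{t-1}', …, y_{t-p}')'`. -/
def lagged (t : ℤ) (ω : Ω) : Cols k p n → ℝ :=
  Sum.elim (M.psi t ω) (fun c => M.y (t - ((c.1 : ℕ) + 1 : ℤ)) ω c.2)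

/-- The residual `ξ_t = Σ_t^{1/2} ε_t`. -/
def xi (t : ℤ) (ω : Ω) : Fin n → ℝ := M.chol t ω *ᵥ M.eps t ω

/-- The regime vector `s = (s_1, …, s_T)`. -/
def sVec (ω : Ω) : Times 1 T → Fin N := fun t => M.s t ω

/-- The initial information `𝓕_0`. -/
@[reducible] def F0 : MeasurableSpace Ω :=
  (⨆ t ∈ Finset.Icc (1 - (p : ℤ) - Tpast) 0, MeasurableSpace.comap (M.y t) inferInstance) ⊔
  (⨆ t ∈ Finset.Icc (1 - (Tpast : ℤ)) T, MeasurableSpace.comap (M.psi t) inferInstance) ⊔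
  (⨆ t ∈ Finset.Icc (1 - (q' : ℤ)) 0, MeasurableSpace.comap (M.Sig t) inferInstance)

/-- `𝓕_t = 𝓕_0 ∨ σ(y_1, …, y_t)`. -/
@[reducible] def F (t : ℤ) : MeasurableSpace Ω :=
  M.F0 ⊔ ⨆ u ∈ Finset.Icc 1 t, MeasurableSpace.comap (M.y u) inferInstance

/-- `σ(s_1, …, s_t)`. -/
@[reducible] def sigmaRegimes (t : ℤ) : MeasurableSpace Ω :=
  ⨆ u ∈ Finset.Icc 1 t, MeasurableSpace.comap (M.s u) inferInstance

/-- The `σ`-field of the transition matrix. -/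
@[reducible] def sigmaTrans : MeasurableSpace Ω := MeasurableSpace.comap M.trans inferInstance

/-- `σ(Π) ∨ σ(Γ)`, for the coefficient matrices of all regimes. -/
@[reducible] def sigmaCoeff : MeasurableSpace Ω :=
  (⨆ j, MeasurableSpace.comap (M.Pi j) inferInstance) ⊔
  (⨆ j, MeasurableSpace.comap (M.Gam j) inferInstance)

/-- `σ(ε_1, …, ε_T)`. -/
@[reducible] def sigmaNoise : MeasurableSpace Ω :=
  ⨆ t ∈ Finset.Icc (1 : ℤ) T, MeasurableSpace.comap (M.eps t) inferInstance

/-- `𝓗_t = 𝓕_t ∨ σ(Π) ∨ σ(Γ) ∨ σ(P) ∨ σ(s)`. -/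
@[reducible] def H (t : ℤ) : MeasurableSpace Ω :=
  M.F t ⊔ M.sigmaCoeff ⊔ M.sigmaTrans ⊔ M.sigmaRegimes T

/-- `IBefore t` is `𝓘_{t-1} = 𝓕_{t-1} ∨ σ(Π_1, …, Π_t) ∨ σ(Γ_1, …, Γ_t) ∨ σ(P) ∨ σ(s_1, …, s_t)`. -/
@[reducible] def IBefore (t : ℤ) : MeasurableSpace Ω :=
  M.F (t - 1) ⊔
  (⨆ u ∈ Finset.Icc 1 t, MeasurableSpace.comap (M.PiAt u) inferInstance) ⊔
  (⨆ u ∈ Finset.Icc 1 t, MeasurableSpace.comap (M.GamAt u) inferInstance) ⊔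
  M.sigmaTrans ⊔ M.sigmaRegimes t

/-- The assumptions of the Bayesian MS-VAR(`p`) model under the real-world measure `μ`. -/
structure IsModel [mΩ : MeasurableSpace Ω] (μ : Measure Ω) : Prop where
  measurable_y : ∀ t, Measurable (M.y t)
  measurable_psi : ∀ t, Measurable (M.psi t)
  measurable_Sig : ∀ t, Measurable (M.Sig t)
  measurable_eps : ∀ t, Measurable (M.eps t)
  measurable_s : ∀ t, Measurable (M.s t)
  measurable_trans : Measurable M.trans
  measurable_Pi : ∀ j, Measurable (M.Pi j)
  measurable_Gam : ∀ j, Measurable (M.Gam j)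
  /-- `y_t = Π_t Y_{t-1} + ξ_t` -/
  equation : ∀ t ∈ Finset.Icc (1 : ℤ) T, ∀ ω,
    M.y t ω = M.PiAt t ω *ᵥ M.lagged t ω + M.xi t ω
  /-- `Σ_t` is positive definite and `𝓘_{t-1}`-measurable -/
  posDef : ∀ t ∈ Finset.Icc (1 : ℤ) T, ∀ ω, (M.Sig t ω).PosDef
  predictable : ∀ t ∈ Finset.Icc (1 : ℤ) T, Measurable[M.IBefore t] (M.Sig t)
  cholesky : ∀ t ∈ Finset.Icc (1 : ℤ) T, ∀ ω, IsCholeskyFactor (M.chol t ω) (M.Sig t ω)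
  /-- `ε_1, …, ε_T` are independent and `N(0, I_n)` -/
  noise_law : ∀ t ∈ Finset.Icc (1 : ℤ) T,
    HasLaw (fun ω => WithLp.toLp 2 (M.eps t ω)) (multivariateGaussian 0 1) μ
  noise_indep : iIndepFun (fun (t : Times 1 T) => M.eps t) μ
  /-- the noise is independent of the initial information … -/
  noise_indep_init : Indep M.sigmaNoise M.F0 μ
  /-- … and, conditionally on it, of the coefficients, the transition matrix and the regimes -/
  noise_condIndep : CondIndepFields μ M.F0 M.sigmaNoise
    (M.sigmaCoeff ⊔ M.sigmaTrans ⊔ M.sigmaRegimes T)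
  /-- the transition matrix is independent of `(Π, Γ)` given `𝓕_0` and `s` -/
  trans_condIndep : CondIndepFields μ (M.F0 ⊔ M.sigmaRegimes T) M.sigmaTrans M.sigmaCoeff
  /-- the transition matrix is a stochastic matrix -/
  trans_stochastic : ∀ ω i, (∀ j, 0 ≤ M.trans ω i j) ∧ ∑ j, M.trans ω i j = 1
  /-- given the transition matrix and `𝓕_0`, the regimes form a homogeneous Markov chain -/
  markov : ∀ t ∈ Finset.Icc (1 : ℤ) (T - 1), ∀ j,
    μ⟦{ω | M.s (t + 1) ω = j} | M.F0 ⊔ M.sigmaTrans ⊔ M.sigmaRegimes t⟧ =ᵐ[μ]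
      fun ω => M.trans ω (M.s t ω) j

section Girsanov

variable (θ : ℤ → Ω → Fin n → ℝ) (Δ : ℤ → Ω → Matrix (Fin n) (Cols k p n) ℝ)

/-- The state price density
`L_t = ∏_{m=1}^t exp(θ_m' Σ_m⁻¹ ξ_m - ½ θ_m' Σ_m⁻¹ θ_m)`. -/
def stateDensity (t : ℤ) (ω : Ω) : ℝ :=
  ∏ m ∈ Finset.Icc 1 t, Real.exp (θ m ω ⬝ᵥ ((M.Sig m ω)⁻¹ *ᵥ M.xi m ω)
    - 1 / 2 * (θ m ω ⬝ᵥ ((M.Sig m ω)⁻¹ *ᵥ θ m ω)))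

/-- The risk-neutral measure, with density `L_T` with respect to `μ`. -/
def riskNeutral [MeasurableSpace Ω] (μ : Measure Ω) : Measure Ω :=
  μ.withDensity (fun ω => ENNReal.ofReal (M.stateDensity θ T ω))

/-- `θ` is a Girsanov kernel that is linear in past values: `θ_t` is `𝓘_{t-1}`-measurable and
`θ_t = Δ_{0,t} ψ_t + Δ_{1,t} y_{t-1} + ⋯ + Δ_{p,t} y_{t-p}` with
`Δ_t = [Δ_{0,t} : ⋯ : Δ_{p,t}]` being `𝓗_t`-measurable. -/
def IsLinearKernel : Prop :=
  ∀ t ∈ Finset.Icc (1 : ℤ) T, Measurable[M.IBefore t] (θ t) ∧ Measurable[M.H t] (Δ t) ∧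
    ∀ ω, θ t ω = Δ t ω *ᵥ M.lagged t ω

/-- The `(t, u)` block of the matrix `Ψ` for times `t`, `u`: `I_n` if `u = t`,
`-(A_{i,t} + Δ_{i,t})` if `u = t - i` with `1 ≤ i ≤ p`, and `0` otherwise. -/
def psiBlock (ω : Ω) (t u : ℤ) : Matrix (Fin n) (Fin n) ℝ :=
  if u = t then 1
  else if h : 1 ≤ t - u ∧ t - u ≤ p then
    -Matrix.of fun i j =>
      (M.PiAt t ω + Δ t ω) i (Sum.inr (⟨(t - u - 1).toNat, by omega⟩, j))
  else 0

/-- The block of `δ` at time `t`: `(A_{0,t} + Δ_{0,t}) ψ_t` plus the sum of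
`(A_{i,t} + Δ_{i,t}) y_{t-i}` over the lags `1 ≤ i ≤ p` with `t - i ≤ 0`. -/
def deltaBlock (ω : Ω) (t : ℤ) : Fin n → ℝ :=
  (M.PiAt t ω + Δ t ω) *ᵥ Sum.elim (M.psi t ω)
    (fun c => if t - ((c.1 : ℕ) + 1 : ℤ) ≤ 0 then M.y (t - ((c.1 : ℕ) + 1 : ℤ)) ω c.2 else 0)

/-- The submatrix of `Ψ` with the block rows of times `a, …, b` and the block columns of
times `c, …, d`. The matrix `Ψ` itself is the case `a = c = 1`, `b = d = T`. -/
def Psi (a b c d : ℤ) (ω : Ω) : Matrix (Times a b × Fin n) (Times c d × Fin n) ℝ :=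
  Matrix.of fun r q => M.psiBlock Δ ω r.1 q.1 r.2 q.2

/-- The blocks `a, …, b` of `δ`, stacked. -/
def delta (a b : ℤ) (ω : Ω) : Times a b × Fin n → ℝ := fun r => M.deltaBlock Δ ω r.1 r.2

/-- `C₂₁ = -Ψ₂₂⁻¹ Ψ₂₁ Ψ₁₁⁻¹` for the partition of `Ψ` after time `t`. -/
def C21 (t : ℤ) (ω : Ω) : Matrix (Times (t + 1) T × Fin n) (Times 1 t × Fin n) ℝ :=
  -((M.Psi Δ (t + 1) T (t + 1) T ω)⁻¹ * M.Psi Δ (t + 1) T 1 t ω * (M.Psi Δ 1 t 1 t ω)⁻¹)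

end Girsanov

/-- `diag(Σ_a, …, Σ_b)`. -/
def SigDiag (a b : ℤ) (ω : Ω) : Matrix (Times a b × Fin n) (Times a b × Fin n) ℝ :=
  Matrix.of fun r q => if r.1 = q.1 then M.Sig r.1 ω r.2 q.2 else 0

/-- `(y_a', …, y_b')'`. -/
def yStack (a b : ℤ) (ω : Ω) : Times a b × Fin n → ℝ := fun r => M.y r.1 ω r.2

end MSVAR

end

/-!
Put `η_t = Σ_t^{-1/2} θ_t`. The `t`-th factor of the density `L_T` is `exp(η_t' ε_t - |η_t|² / 2)`,
where `ε_t` is standard normal and independent of `𝓗_{t-1}`, and `η_t` is `𝓗_{t-1}`-measurable. By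
the Cameron–Martin formula, `ε̃_t = ε_t - η_t` is therefore standard normal given `𝓗_{t-1}` under
the risk-neutral measure. Since `y_t = Π_t Y_{t-1} + θ_t + Σ_t^{1/2} ε̃_t` and `θ_t` is linear in
`Y_{t-1}`, the stacked vector solves `Ψ y = δ + diag(Σ_t^{1/2}) ε̃` with `Ψ` block unit lower
triangular, so `y` and its blocks are affine images of standard normal vectors. The density has
conditional mean one given `𝓗_0`, so the two measures agree on `𝓗_0`, and hence so do their
conditional probabilities of events about regimes and coefficients.
-/

section SigmaFields

variable {Ω : Type*} {m m' m₁ m₂ m₃ mΩ : MeasurableSpace Ω} {μ : Measure Ω}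

lemma generateFrom_image2_inter_eq_sup (m₁ m₂ : MeasurableSpace Ω) :
    MeasurableSpace.generateFrom
      (Set.image2 (· ∩ ·) {A | MeasurableSet[m₁] A} {B | MeasurableSet[m₂] B}) = m₁ ⊔ m₂ := by
  apply le_antisymm
  · refine MeasurableSpace.generateFrom_le ?_
    rintro _ ⟨A, hA, B, hB, rfl⟩
    exact .inter ((le_sup_left : m₁ ≤ m₁ ⊔ m₂) _ hA) ((le_sup_right : m₂ ≤ m₁ ⊔ m₂) _ hB)
  · refine sup_le (fun A hA => ?_) (fun B hB => ?_)
    · exact MeasurableSpace.measurableSet_generateFrom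
        ⟨A, hA, Set.univ, MeasurableSet.univ, Set.inter_univ A⟩
    · exact MeasurableSpace.measurableSet_generateFrom
        ⟨Set.univ, MeasurableSet.univ, B, hB, Set.univ_inter B⟩

lemma isPiSystem_image2_inter {C D : Set (Set Ω)} (hC : IsPiSystem C) (hD : IsPiSystem D) :
    IsPiSystem (Set.image2 (· ∩ ·) C D) := by
  rintro _ ⟨A, hA, B, hB, rfl⟩ _ ⟨A', hA', B', hB', rfl⟩ hne
  rw [Set.inter_inter_inter_comm] at hne ⊢
  exact ⟨_, hC A hA A' hA' hne.left, _, hD B hB B' hB' hne.right, rfl⟩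

lemma isPiSystem_image2_inter_measurableSet (m₁ m₂ : MeasurableSpace Ω) :
    IsPiSystem (Set.image2 (· ∩ ·) {A | MeasurableSet[m₁] A} {B | MeasurableSet[m₂] B}) :=
  isPiSystem_image2_inter (@MeasurableSpace.isPiSystem_measurableSet Ω m₁)
    (@MeasurableSpace.isPiSystem_measurableSet Ω m₂)

lemma indep_sup_right_of_indep_sup_left [IsZeroOrProbabilityMeasure μ] (h₁ : m₁ ≤ mΩ) (h₂ : m₂ ≤ mΩ)
    (h₃ : m₃ ≤ mΩ) (h₁₂ : Indep m₁ m₂ μ) (h : Indep (m₁ ⊔ m₂) m₃ μ) : Indep m₁ (m₂ ⊔ m₃) μ := by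
  refine IndepSets.indep h₁ (sup_le h₂ h₃) (@MeasurableSpace.isPiSystem_measurableSet _ m₁)
    (isPiSystem_image2_inter_measurableSet m₂ m₃)
    (@MeasurableSpace.generateFrom_measurableSet _ m₁).symm
    (generateFrom_image2_inter_eq_sup m₂ m₃).symm ?_
  rw [IndepSets_iff]
  rintro A _ hA ⟨B, hB, C, hC, rfl⟩
  have hA' : MeasurableSet[m₁ ⊔ m₂] A := (le_sup_left : m₁ ≤ m₁ ⊔ m₂) _ hA
  have hB' : MeasurableSet[m₁ ⊔ m₂] B := (le_sup_right : m₂ ≤ m₁ ⊔ m₂) _ hB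
  rw [Indep_iff] at h h₁₂
  rw [← Set.inter_assoc, h _ _ (hA'.inter hB') hC, h _ _ hB' hC, h₁₂ _ _ hA hB, mul_assoc]

lemma setIntegral_condExp_indicator [IsFiniteMeasure μ] (hm : m ≤ mΩ) {S D : Set Ω}
    (hS : MeasurableSet S) (hD : MeasurableSet[m] D) :
    ∫ ω in D, (μ⟦S | m⟧) ω ∂μ = μ.real (S ∩ D) := by
  rw [setIntegral_condExp hm ((integrable_const _).indicator hS) hD, integral_indicator_const _ hS,
    measureReal_restrict_apply hS, smul_eq_mul, mul_one]

lemma setIntegral_eq_setIntegral_of_isPiSystem [IsFiniteMeasure μ] (hm : m ≤ mΩ) {f g : Ω → ℝ}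
    (hf : Integrable f μ) (hg : Integrable g μ) {C : Set (Set Ω)}
    (hgen : m = MeasurableSpace.generateFrom C) (hC : IsPiSystem C)
    (huniv : ∫ ω, f ω ∂μ = ∫ ω, g ω ∂μ)
    (h : ∀ A ∈ C, ∫ ω in A, f ω ∂μ = ∫ ω in A, g ω ∂μ) {A : Set Ω} (hA : MeasurableSet[m] A) :
    ∫ ω in A, f ω ∂μ = ∫ ω in A, g ω ∂μ := by
  induction A, hA using MeasurableSpace.induction_on_inter hgen hC with
  | empty => simp
  | basic A hA => exact h A hA
  | compl A hA ih =>
    rw [setIntegral_compl (hm A hA) hf, setIntegral_compl (hm A hA) hg, huniv, ih]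
  | iUnion B hd hB ih =>
    have hB' : ∀ i, MeasurableSet (B i) := fun i => hm _ (hB i)
    rw [integral_iUnion hB' hd hf.integrableOn, integral_iUnion hB' hd hg.integrableOn]
    exact tsum_congr ih

namespace CondIndepFields

lemma symm (h : CondIndepFields μ m m₁ m₂) : CondIndepFields μ m m₂ m₁ := fun A B hA hB => by
  rw [Set.inter_comm, mul_comm]
  exact h B A hB hA

lemma setIntegral_inter_condExp [IsFiniteMeasure μ] (h : CondIndepFields μ m m₁ m₂) (hm : m ≤ mΩ)
    (h₁ : m₁ ≤ mΩ) (h₂ : m₂ ≤ mΩ) {A B D : Set Ω} (hA : MeasurableSet[m₁] A)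
    (hB : MeasurableSet[m₂] B) (hD : MeasurableSet[m] D) :
    ∫ ω in D ∩ A, (μ⟦B | m⟧) ω ∂μ = μ.real (B ∩ (D ∩ A)) := by
  have hA0 : MeasurableSet A := h₁ _ hA
  have hprod : (A.indicator fun _ => (1 : ℝ)) * μ⟦B | m⟧ = A.indicator (μ⟦B | m⟧) := by
    ext ω
    by_cases hω : ω ∈ A <;> simp [hω]
  have hint : Integrable ((A.indicator fun _ => (1 : ℝ)) * μ⟦B | m⟧) μ :=
    hprod ▸ integrable_condExp.indicator hA0
  have hcond : μ[(A.indicator fun _ => (1 : ℝ)) * μ⟦B | m⟧ | m] =ᵐ[μ] μ⟦A ∩ B | m⟧ :=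
    (condExp_mul_of_stronglyMeasurable_right stronglyMeasurable_condExp hint
      ((integrable_const _).indicator hA0)).trans (h A B hA hB).symm
  calc ∫ ω in D ∩ A, (μ⟦B | m⟧) ω ∂μ
      = ∫ ω in D, ((A.indicator fun _ => (1 : ℝ)) * μ⟦B | m⟧) ω ∂μ := by
        rw [hprod, setIntegral_indicator hA0]
    _ = ∫ ω in D, (μ⟦A ∩ B | m⟧) ω ∂μ := by
        rw [← setIntegral_condExp hm hint hD]
        exact integral_congr_ae (ae_restrict_of_ae hcond)
    _ = μ.real (B ∩ (D ∩ A)) := by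
        rw [setIntegral_condExp_indicator hm (hA0.inter (h₂ _ hB)) hD, Set.inter_comm A,
          Set.inter_assoc, Set.inter_comm A]

lemma condExp_sup_ae_eq [IsFiniteMeasure μ] (h : CondIndepFields μ m m₁ m₂) (hm : m ≤ mΩ)
    (h₁ : m₁ ≤ mΩ) (h₂ : m₂ ≤ mΩ) {B : Set Ω} (hB : MeasurableSet[m₂] B) :
    μ⟦B | m ⊔ m₁⟧ =ᵐ[μ] μ⟦B | m⟧ := by
  have hB0 : MeasurableSet B := h₂ _ hB
  have hind : Integrable (B.indicator fun _ => (1 : ℝ)) μ := (integrable_const _).indicator hB0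
  have hmeas : StronglyMeasurable[m ⊔ m₁] (μ⟦B | m⟧) :=
    StronglyMeasurable.mono stronglyMeasurable_condExp le_sup_left
  refine (ae_eq_condExp_of_forall_setIntegral_eq (sup_le hm h₁) hind
    (fun _ _ _ => integrable_condExp.integrableOn) (fun S hS _ => ?_)
    hmeas.aestronglyMeasurable).symm
  refine setIntegral_eq_setIntegral_of_isPiSystem (sup_le hm h₁) integrable_condExp hind
    (generateFrom_image2_inter_eq_sup m m₁).symm (isPiSystem_image2_inter_measurableSet m m₁)
    (integral_condExp hm) ?_ hS
  rintro _ ⟨D, hD, A, hA, rfl⟩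
  rw [h.setIntegral_inter_condExp hm h₁ h₂ hA hB hD, integral_indicator_const _ hB0,
    measureReal_restrict_apply hB0, smul_eq_mul, mul_one]

lemma indep_sup [IsFiniteMeasure μ] (h : CondIndepFields μ m m₁ m₂) (hm : m ≤ mΩ)
    (h₁ : m₁ ≤ mΩ) (h₂ : m₂ ≤ mΩ) (hi : Indep m₁ m μ) : Indep m₁ (m ⊔ m₂) μ := by
  rw [Indep_iff]
  intro A D hA hD
  have hA0 : MeasurableSet A := h₁ _ hA
  have hcond : μ⟦A | m ⊔ m₂⟧ =ᵐ[μ] fun _ => μ.real A := by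
    refine (h.symm.condExp_sup_ae_eq hm h₂ h₁ hA).trans ?_
    simpa [integral_indicator_const _ hA0] using
      condExp_indep_eq h₁ hm (f := A.indicator fun _ => (1 : ℝ))
        (stronglyMeasurable_const.indicator hA) hi
  have hreal : μ.real (A ∩ D) = μ.real A * μ.real D := by
    rw [← setIntegral_condExp_indicator (sup_le hm h₂) hA0 hD,
      integral_congr_ae (ae_restrict_of_ae hcond), setIntegral_const, smul_eq_mul, mul_comm]
  rwa [← ENNReal.toReal_eq_toReal_iff' (by finiteness) (by finiteness), ENNReal.toReal_mul]

end CondIndepFields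

lemma trim_eq_trim_of_measure_eq {ν : Measure Ω} (hm : m ≤ mΩ)
    (h : ∀ A, MeasurableSet[m] A → ν A = μ A) : ν.trim hm = μ.trim hm :=
  @Measure.ext _ m _ _ fun A hA => by
    rw [trim_measurableSet_eq hm hA, trim_measurableSet_eq hm hA, h A hA]

lemma condExp_indicator_ae_eq_of_measure_eq {ν : Measure Ω} [IsFiniteMeasure μ]
    [IsFiniteMeasure ν] (hmm' : m ≤ m') (hm' : m' ≤ mΩ)
    (h : ∀ A, MeasurableSet[m'] A → ν A = μ A) {S : Set Ω} (hS : MeasurableSet[m'] S) :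
    ν⟦S | m⟧ =ᵐ[μ] μ⟦S | m⟧ := by
  have hle := hmm'.trans hm'
  have hS0 : MeasurableSet S := hm' _ hS
  have htrim := trim_eq_trim_of_measure_eq hle fun A hA => h A (hmm' _ hA)
  have hint : Integrable (ν⟦S | m⟧) μ := by
    refine integrable_of_integrable_trim hle ?_
    rw [← htrim]
    exact integrable_condExp.trim hle stronglyMeasurable_condExp
  refine ae_eq_condExp_of_forall_setIntegral_eq hle ((integrable_const _).indicator hS0)
    (fun _ _ _ => hint.integrableOn) (fun A hA _ => ?_)
    stronglyMeasurable_condExp.aestronglyMeasurable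
  rw [setIntegral_trim hle stronglyMeasurable_condExp hA, ← htrim,
    ← setIntegral_trim hle stronglyMeasurable_condExp hA, setIntegral_condExp_indicator hle hS0 hA,
    integral_indicator_const _ hS0, measureReal_restrict_apply hS0, smul_eq_mul, mul_one,
    measureReal_def, measureReal_def, h _ (hS.inter (hmm' _ hA))]

lemma condExp_indicator_mem_ae_eq_sum {β : Type*} [Fintype β] [MeasurableSpace β]
    [MeasurableSingletonClass β] [IsFiniteMeasure μ] (hm : m ≤ mΩ) {s : Ω → β}
    (hs : Measurable[m] s) {A : β → Set Ω} (hA : ∀ b, MeasurableSet (A b)) :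
    μ⟦{ω | ω ∈ A (s ω)} | m⟧ =ᵐ[μ] ∑ b, (s ⁻¹' {b}).indicator (μ⟦A b | m⟧) := by
  have hind : ∀ b, Integrable ((A b).indicator fun _ => (1 : ℝ)) μ :=
    fun b => (integrable_const _).indicator (hA b)
  have hsb : ∀ b, MeasurableSet[m] (s ⁻¹' {b}) := fun b => hs (measurableSet_singleton b)
  have hsum : ({ω | ω ∈ A (s ω)}.indicator fun _ => (1 : ℝ)) =
      ∑ b, (s ⁻¹' {b}).indicator ((A b).indicator fun _ => (1 : ℝ)) := by
    ext ω
    rw [Finset.sum_apply, Finset.sum_eq_single (s ω)]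
    · simp [Set.indicator]
    · intro b _ hb
      exact Set.indicator_of_notMem (fun hc => hb hc.symm) _
    · simp
  rw [hsum]
  refine (condExp_finsetSum (fun b _ => (hind b).indicator (hm _ (hsb b))) m).trans ?_
  filter_upwards [ae_all_iff.2 fun b => condExp_indicator (hind b) (hsb b)] with ω hω
  simp only [Finset.sum_apply]
  exact Finset.sum_congr rfl fun b _ => hω b

lemma condExp_indicator_mem_ae_eq {β : Type*} [Finite β] [MeasurableSpace β]
    [MeasurableSingletonClass β] [IsFiniteMeasure μ] (hmm' : m ≤ m')
    (hm' : m' ≤ mΩ) {s : Ω → β} (hs : Measurable[m] s) {A : β → Set Ω}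
    (hA : ∀ b, MeasurableSet (A b)) (h : ∀ b, μ⟦A b | m'⟧ =ᵐ[μ] μ⟦A b | m⟧) :
    μ⟦{ω | ω ∈ A (s ω)} | m'⟧ =ᵐ[μ] μ⟦{ω | ω ∈ A (s ω)} | m⟧ := by
  have := Fintype.ofFinite β
  refine (condExp_indicator_mem_ae_eq_sum hm' (hs.mono hmm' le_rfl) hA).trans
    (Filter.EventuallyEq.trans ?_ (condExp_indicator_mem_ae_eq_sum (hmm'.trans hm') hs hA).symm)
  filter_upwards [ae_all_iff.2 h] with ω hω
  simp only [Finset.sum_apply, Set.indicator, hω]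

end SigmaFields

lemma measurable_indicator_one {Ω : Type*} {m : MeasurableSpace Ω} {A : Set Ω}
    (hA : MeasurableSet[m] A) : Measurable[m] (A.indicator (1 : Ω → ENNReal)) :=
  measurable_one.indicator hA

section MeasurableMatrix

variable {Ω ι κ ι' : Type*} {m : MeasurableSpace Ω}

lemma measurable_matrix_of_apply {B : Ω → Matrix ι κ ℝ}
    (h : ∀ i j, Measurable fun ω => B ω i j) : Measurable B :=
  measurable_pi_lambda _ fun i => measurable_pi_lambda _ fun j => h i j

lemma measurable_matrix_apply {B : Ω → Matrix ι κ ℝ} (h : Measurable B) (i : ι) (j : κ) :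
    Measurable fun ω => B ω i j :=
  (measurable_pi_apply j).comp ((measurable_pi_apply i).comp h)

lemma measurable_matrix_transpose {B : Ω → Matrix ι κ ℝ} (hB : Measurable B) :
    Measurable fun ω => (B ω)ᵀ :=
  measurable_matrix_of_apply fun i j => measurable_matrix_apply hB j i

lemma measurable_matrix_neg {B : Ω → Matrix ι κ ℝ} (hB : Measurable B) :
    Measurable fun ω => -B ω :=
  measurable_matrix_of_apply fun i j => (measurable_matrix_apply hB i j).neg

lemma measurable_matrix_fromCols {B : Ω → Matrix ι κ ℝ} {C : Ω → Matrix ι ι' ℝ}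
    (hB : Measurable B) (hC : Measurable C) : Measurable fun ω => fromCols (B ω) (C ω) :=
  measurable_matrix_of_apply fun i j => by
    cases j
    exacts [measurable_matrix_apply hB i _, measurable_matrix_apply hC i _]

lemma measurable_matrix_mulVec [Fintype κ] {B : Ω → Matrix ι κ ℝ} {v : Ω → κ → ℝ}
    (hB : Measurable B) (hv : Measurable v) : Measurable fun ω => B ω *ᵥ v ω :=
  measurable_pi_lambda _ fun i => Finset.measurable_sum _ fun j _ =>
    (measurable_matrix_apply hB i j).mul ((measurable_pi_apply j).comp hv)

lemma measurable_matrix_mul [Fintype κ] {B : Ω → Matrix ι κ ℝ} {C : Ω → Matrix κ ι' ℝ}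
    (hB : Measurable B) (hC : Measurable C) : Measurable fun ω => B ω * C ω :=
  measurable_matrix_of_apply fun i j => Finset.measurable_sum _ fun l _ =>
    (measurable_matrix_apply hB i l).mul (measurable_matrix_apply hC l j)

lemma measurable_matrix_det [Fintype ι] [DecidableEq ι] {B : Ω → Matrix ι ι ℝ}
    (hB : Measurable B) : Measurable fun ω => (B ω).det := by
  simp only [det_apply']
  exact Finset.measurable_sum _ fun σ _ => measurable_const.mul
    (Finset.measurable_prod _ fun i _ => measurable_matrix_apply hB _ _)

lemma measurable_matrix_inv [Fintype ι] [DecidableEq ι] {B : Ω → Matrix ι ι ℝ}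
    (hB : Measurable B) : Measurable fun ω => (B ω)⁻¹ := by
  refine measurable_matrix_of_apply fun i j => ?_
  simp only [inv_def, Matrix.smul_apply, smul_eq_mul, Ring.inverse_eq_inv', adjugate_apply]
  refine (measurable_matrix_det hB).inv.mul
    (measurable_matrix_det (measurable_matrix_of_apply fun k l => ?_))
  obtain rfl | hk := eq_or_ne k j
  · simp
  · simpa [updateRow_ne hk] using measurable_matrix_apply hB k l

lemma measurable_dotProduct [Fintype κ] {u v : Ω → κ → ℝ} (hu : Measurable u)
    (hv : Measurable v) : Measurable fun ω => u ω ⬝ᵥ v ω :=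
  Finset.measurable_sum _ fun i _ =>
    ((measurable_pi_apply i).comp hu).mul ((measurable_pi_apply i).comp hv)

end MeasurableMatrix

namespace IsCholeskyFactor

variable {n : ℕ}

section

variable {L S : Matrix (Fin n) (Fin n) ℝ}

lemma apply_eq_sum_add (h : IsCholeskyFactor L S) (i j : Fin n) :
    S i j = (∑ l ∈ Finset.univ.filter (· < j), L i l * L j l) + L i j * L j j := by
  rw [← h.2.2, mul_apply, ← Finset.sum_filter_add_sum_filter_not Finset.univ (· < j)]
  congr 1
  refine Finset.sum_eq_single j (fun l hl hlj => ?_) (fun hj => by simp at hj)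
  have hjl : j < l := lt_of_le_of_ne (by simpa using hl) hlj.symm
  rw [transpose_apply, h.1 j l hjl, mul_zero]

lemma apply_self (h : IsCholeskyFactor L S) (j : Fin n) :
    L j j = √(S j j - ∑ l ∈ Finset.univ.filter (· < j), L j l * L j l) := by
  rw [h.apply_eq_sum_add j j, add_sub_cancel_left, Real.sqrt_mul_self (h.2.1 j).le]

lemma apply_eq_div (h : IsCholeskyFactor L S) (i j : Fin n) :
    L i j = (S i j - ∑ l ∈ Finset.univ.filter (· < j), L i l * L j l) / L j j := by
  rw [h.apply_eq_sum_add i j, add_sub_cancel_left, mul_div_cancel_right₀ _ (h.2.1 j).ne']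

lemma isUnit_det (h : IsCholeskyFactor L S) : IsUnit L.det := by
  rw [det_of_isLowerTriangular L fun i j hij => h.1 i j hij]
  exact (Finset.prod_pos fun i _ => h.2.1 i).ne'.isUnit

end

lemma measurable {Ω : Type*} {m : MeasurableSpace Ω} {L S : Ω → Matrix (Fin n) (Fin n) ℝ}
    (h : ∀ ω, IsCholeskyFactor (L ω) (S ω)) (hS : Measurable S) : Measurable L := by
  suffices hcol : ∀ j i, Measurable fun ω => L ω i j from
    measurable_matrix_of_apply fun i j => hcol j i
  intro j
  induction j using WellFoundedLT.induction with
  | ind j ih =>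
    have hsum : ∀ i, Measurable fun ω => ∑ l ∈ Finset.univ.filter (· < j), L ω i l * L ω j l :=
      fun i => Finset.measurable_sum _ fun l hl =>
        (ih l (Finset.mem_filter.1 hl).2 i).mul (ih l (Finset.mem_filter.1 hl).2 j)
    have hdiag : Measurable fun ω => L ω j j := by
      simp only [fun ω => (h ω).apply_self j]
      exact ((measurable_matrix_apply hS j j).sub (hsum j)).sqrt
    intro i
    simp only [fun ω => (h ω).apply_eq_div i j]
    exact ((measurable_matrix_apply hS i j).sub (hsum i)).div hdiag

end IsCholeskyFactor

section StdNormal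

variable {κ κ' : Type*} [Fintype κ] [Fintype κ']

/-- The standard normal distribution `N(0, I)` on `κ → ℝ`. Unlike Mathlib's `stdGaussian`, it
lives on a plain function space, as the random vectors of `MSVAR` do. -/
noncomputable def stdNormal (κ : Type*) [Fintype κ] : Measure (κ → ℝ) :=
  Measure.pi fun _ => gaussianReal 0 1

instance : IsProbabilityMeasure (stdNormal κ) := by
  unfold stdNormal
  infer_instance

lemma stdNormal_map_comp_injective {e : κ' → κ} (he : Function.Injective e) :
    (stdNormal κ).map (fun z i => z (e i)) = stdNormal κ' := by
  have hind : iIndepFun (fun i (z : κ → ℝ) => z i) (stdNormal κ) :=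
    iIndepFun_pi (X := fun _ x => x) fun _ => aemeasurable_id
  rw [(iIndepFun_iff_map_fun_eq_pi_map
    fun i => (measurable_pi_apply (e i)).aemeasurable).1 (hind.precomp he)]
  exact congrArg Measure.pi (funext fun i =>
    (measurePreserving_eval (fun _ : κ => gaussianReal 0 1) (e i)).map_eq)

lemma stdNormal_prod_map_sumElim :
    ((stdNormal κ).prod (stdNormal κ')).map (fun q => Sum.elim q.1 q.2) =
      stdNormal (κ ⊕ κ') :=
  (measurePreserving_sumPiEquivProdPi_symm fun _ : κ ⊕ κ' => gaussianReal 0 1).map_eq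

lemma stdNormal_map_toLp :
    (stdNormal κ).map (WithLp.toLp 2) = stdGaussian (EuclideanSpace ℝ κ) :=
  map_pi_eq_stdGaussian

lemma map_eq_stdNormal_of_hasLaw {Ω : Type*} {mΩ : MeasurableSpace Ω} {μ : Measure Ω}
    [DecidableEq κ] {Z : Ω → κ → ℝ} (hZ : Measurable Z)
    (h : HasLaw (fun ω => WithLp.toLp 2 (Z ω)) (multivariateGaussian 0 1) μ) :
    μ.map Z = stdNormal κ := by
  have hlaw := h.map_eq
  rw [multivariateGaussian_zero_one, ← stdNormal_map_toLp] at hlaw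
  have hofLp := congrArg (Measure.map (WithLp.ofLp (p := 2))) hlaw
  rw [Measure.map_map (by fun_prop) (by fun_prop),
    Measure.map_map (by fun_prop) (by fun_prop)] at hofLp
  simpa [Function.comp_def] using hofLp

lemma posSemidef_mul_transpose {ι : Type*} [Finite ι] (B : Matrix ι κ ℝ) : (B * Bᵀ).PosSemidef := by
  simpa [conjTranspose_eq_transpose_of_trivial] using posSemidef_self_mul_conjTranspose B

lemma stdNormal_map_affine {ι : Type*} [Fintype ι] [DecidableEq ι] (a : ι → ℝ)
    (B : Matrix ι κ ℝ) :
    (stdNormal κ).map (fun z => WithLp.toLp 2 (a + B *ᵥ z)) =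
      multivariateGaussian (WithLp.toLp 2 a) (B * Bᵀ) := by
  classical
  let L : EuclideanSpace ℝ κ →L[ℝ] EuclideanSpace ℝ ι := (toEuclideanLin B).toContinuousLinearMap
  have hmap : (stdNormal κ).map (fun z => WithLp.toLp 2 (a + B *ᵥ z)) =
      ((stdGaussian (EuclideanSpace ℝ κ)).map L).map (WithLp.toLp 2 a + ·) := by
    rw [← stdNormal_map_toLp, Measure.map_map (by fun_prop) (by fun_prop),
      Measure.map_map (by fun_prop) (by fun_prop)]
    rfl
  rw [hmap]
  apply IsGaussian.ext
  · rw [integral_map (by fun_prop) (by fun_prop)]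
    simp only [id_eq]
    rw [integral_add (integrable_const _) IsGaussian.integrable_fun_id, integral_const,
      L.integral_id_map IsGaussian.integrable_fun_id, integral_id_stdGaussian,
      integral_id_multivariateGaussian]
    simp
  · have hadj : ∀ x, L.adjoint x = WithLp.toLp 2 (Bᵀ *ᵥ x.ofLp) := fun x =>
      (LinearMap.congr_fun (toEuclideanLin_conjTranspose_eq_adjoint B) x).symm
    ext x y
    rw [covarianceBilin_map_const_add, covarianceBilin_map IsGaussian.memLp_two_id,
      covarianceBilin_stdGaussian, hadj, hadj,
      covarianceBilin_multivariateGaussian (posSemidef_mul_transpose B), innerSL_apply_apply,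
      EuclideanSpace.inner_toLp_toLp, star_trivial, dotProduct_comm, ← mulVec_mulVec,
      dotProduct_mulVec x.ofLp, ← mulVec_transpose]

end StdNormal

lemma exists_equiv_times_succ (κ : Type*) {a b : ℤ} (hab : a ≤ b) :
    ∃ e : Times (a + 1) (b + 1) × κ ≃ (Times (a + 1) b × κ) ⊕ κ, ∀ (z : ℤ → κ → ℝ) r,
      Sum.elim (fun r : Times (a + 1) b × κ => z r.1 r.2) (z (b + 1)) (e r) = z r.1 r.2 := by
  let d : (Times (a + 1) b × κ) ⊕ κ → Times (a + 1) (b + 1) × κ := Sum.elim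
    (fun r => (⟨r.1, Finset.Icc_subset_Icc_right (by omega) r.1.2⟩, r.2))
    (fun i => (⟨b + 1, Finset.mem_Icc.2 (by omega)⟩, i))
  have hlt : ∀ t : Times (a + 1) b, t.1 ≠ b + 1 := fun t => by
    have := Finset.mem_Icc.1 t.2
    omega
  have hinj : Function.Injective d := by
    rintro (⟨t, i⟩ | i) (⟨u, j⟩ | j) h
    all_goals simp only [d, Sum.elim_inl, Sum.elim_inr, Prod.mk.injEq, Subtype.mk.injEq] at h
    · rw [Subtype.ext h.1, h.2]
    · exact (hlt t h.1).elim
    · exact (hlt u h.1.symm).elim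
    · rw [h.2]
  have hsurj : Function.Surjective d := by
    rintro ⟨⟨t, ht⟩, i⟩
    obtain rfl | hne := eq_or_ne t (b + 1)
    · exact ⟨.inr i, rfl⟩
    · have := Finset.mem_Icc.1 ht
      exact ⟨.inl (⟨t, Finset.mem_Icc.2 (by omega)⟩, i), rfl⟩
  refine ⟨(Equiv.ofBijective d ⟨hinj, hsurj⟩).symm, fun z r => ?_⟩
  obtain ⟨q, rfl⟩ := (Equiv.ofBijective d ⟨hinj, hsurj⟩).surjective r
  rw [Equiv.symm_apply_apply]
  obtain q | q := q <;> rfl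

/-- `Z` is standard normal given the `σ`-field `𝒢` under `Q`. This is encoded without conditional
expectations: restricted to any event `A` of `𝒢`, the law of `Z` is `N(0, I)` with total mass
`Q A`. -/
def IsStdNormalGiven {Ω κ : Type*} [Fintype κ] (𝒢 : MeasurableSpace Ω) {mΩ : MeasurableSpace Ω}
    (Q : Measure Ω) (Z : Ω → κ → ℝ) : Prop :=
  Measurable Z ∧ ∀ A, MeasurableSet[𝒢] A → (Q.restrict A).map Z = Q A • stdNormal κ

namespace IsStdNormalGiven

variable {Ω Ω' κ κ' : Type*} [Fintype κ] [Fintype κ'] [MeasurableSpace Ω']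
  {𝒢 ℋ mΩ : MeasurableSpace Ω} {Q : Measure Ω} {Z : Ω → κ → ℝ}

lemma of_indep [IsZeroOrProbabilityMeasure Q] (hZ : Measurable Z)
    (hlaw : Q.map Z = stdNormal κ)
    (hi : Indep (MeasurableSpace.comap Z inferInstance) 𝒢 Q) : IsStdNormalGiven 𝒢 Q Z := by
  refine ⟨hZ, fun A hA => Measure.ext fun E hE => ?_⟩
  rw [Indep_iff] at hi
  rw [Measure.map_apply hZ hE, Measure.restrict_apply (hZ hE), hi _ _ ⟨E, hE, rfl⟩ hA,
    ← Measure.map_apply hZ hE, hlaw, Measure.smul_apply, smul_eq_mul, mul_comm]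

lemma of_isEmpty [IsEmpty κ] (Z : Ω → κ → ℝ) : IsStdNormalGiven 𝒢 Q Z := by
  have hZ : Measurable Z := measurable_of_subsingleton_codomain Z
  refine ⟨hZ, fun A _ => Measure.ext fun E _ => ?_⟩
  induction E using Subsingleton.set_cases with
  | h0 => simp
  | h1 => simp [Measure.map_apply hZ]

lemma restrict (h : IsStdNormalGiven 𝒢 Q Z) (h𝒢 : 𝒢 ≤ mΩ) {A : Set Ω}
    (hA : MeasurableSet[𝒢] A) : IsStdNormalGiven 𝒢 (Q.restrict A) Z := by
  refine ⟨h.1, fun B hB => ?_⟩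
  rw [Measure.restrict_restrict (h𝒢 _ hB), Measure.restrict_apply (h𝒢 _ hB), h.2 _ (hB.inter hA)]

lemma comp_injective (h : IsStdNormalGiven 𝒢 Q Z) {e : κ' → κ} (he : Function.Injective e) :
    IsStdNormalGiven 𝒢 Q fun ω i => Z ω (e i) := by
  have hcomp : Measurable fun (z : κ → ℝ) i => z (e i) := by fun_prop
  refine ⟨hcomp.comp h.1, fun A hA => ?_⟩
  rw [← stdNormal_map_comp_injective he, ← Measure.map_smul, ← h.2 A hA,
    Measure.map_map hcomp h.1]
  rfl

lemma map_prodMk [IsFiniteMeasure Q] (h : IsStdNormalGiven 𝒢 Q Z) (h𝒢 : 𝒢 ≤ mΩ) {W : Ω → Ω'}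
    (hW : Measurable[𝒢] W) :
    Q.map (fun ω => (W ω, Z ω)) = (Q.map W).prod (stdNormal κ) := by
  have hW0 : Measurable W := hW.mono h𝒢 le_rfl
  refine (Measure.prod_eq fun B E hB hE => ?_).symm
  have hBE := congrArg (fun ν => ν E) (h.2 _ (hW hB))
  rw [Measure.map_apply h.1 hE, Measure.restrict_apply (h.1 hE)] at hBE
  rw [Measure.map_apply (hW0.prodMk h.1) (hB.prod hE), Measure.map_apply hW0 hB,
    Set.mk_preimage_prod, Set.inter_comm, hBE, Measure.smul_apply, smul_eq_mul]

lemma lintegral_eq [IsFiniteMeasure Q] (h : IsStdNormalGiven 𝒢 Q Z) (h𝒢 : 𝒢 ≤ mΩ) {W : Ω → Ω'}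
    (hW : Measurable[𝒢] W) {f : Ω' × (κ → ℝ) → ENNReal} (hf : Measurable f) :
    ∫⁻ ω, f (W ω, Z ω) ∂Q = ∫⁻ ω, ∫⁻ z, f (W ω, z) ∂stdNormal κ ∂Q := by
  have hW0 : Measurable W := hW.mono h𝒢 le_rfl
  rw [← lintegral_map hf (hW0.prodMk h.1), h.map_prodMk h𝒢 hW, lintegral_prod _ hf.aemeasurable,
    lintegral_map hf.lintegral_prod_right' hW0]

lemma sumElim [IsFiniteMeasure Q] (h : IsStdNormalGiven 𝒢 Q Z) (h𝒢 : 𝒢 ≤ ℋ) (hℋ : ℋ ≤ mΩ)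
    (hZ : Measurable[ℋ] Z) {Z' : Ω → κ' → ℝ} (h' : IsStdNormalGiven ℋ Q Z') :
    IsStdNormalGiven 𝒢 Q fun ω => Sum.elim (Z ω) (Z' ω) := by
  have helim : Measurable fun q : (κ → ℝ) × (κ' → ℝ) => Sum.elim q.1 q.2 :=
    measurable_pi_lambda _ <| Sum.rec (fun i => (measurable_pi_apply i).comp measurable_fst)
      fun i => (measurable_pi_apply i).comp measurable_snd
  refine ⟨helim.comp (h.1.prodMk h'.1), fun A hA => ?_⟩
  rw [← stdNormal_prod_map_sumElim, ← Measure.map_smul, ← Measure.prod_smul_left, ← h.2 A hA,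
    ← (h'.restrict hℋ (h𝒢 _ hA)).map_prodMk hℋ hZ, Measure.map_map helim (h.1.prodMk h'.1)]
  rfl

lemma condExp_preimage [IsFiniteMeasure Q] (h : IsStdNormalGiven 𝒢 Q Z) (h𝒢 : 𝒢 ≤ mΩ)
    {W : Ω → Ω'} (hW : Measurable[𝒢] W) {E : Set (Ω' × (κ → ℝ))} (hE : MeasurableSet E) :
    Q⟦{ω | (W ω, Z ω) ∈ E} | 𝒢⟧ =ᵐ[Q] fun ω => (stdNormal κ).real (Prod.mk (W ω) ⁻¹' E) := by
  have hW0 : Measurable W := hW.mono h𝒢 le_rfl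
  have hWZ : Measurable fun ω => (W ω, Z ω) := hW0.prodMk h.1
  have hmeas : Measurable[𝒢] fun ω => stdNormal κ (Prod.mk (W ω) ⁻¹' E) :=
    (measurable_measure_prodMk_left hE).comp hW
  have hint : Integrable (fun ω => (stdNormal κ).real (Prod.mk (W ω) ⁻¹' E)) Q := by
    refine Integrable.of_bound (C := 1)
      (hmeas.ennreal_toReal.mono h𝒢 le_rfl).aestronglyMeasurable (ae_of_all _ fun ω => ?_)
    rw [Real.norm_of_nonneg measureReal_nonneg]
    exact measureReal_le_one
  refine (ae_eq_condExp_of_forall_setIntegral_eq h𝒢 ((integrable_const _).indicator (hWZ hE))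
    (fun _ _ _ => hint.integrableOn) (fun A hA _ => ?_)
    hmeas.ennreal_toReal.stronglyMeasurable.aestronglyMeasurable).symm
  have hsection : ∫⁻ ω in A, stdNormal κ (Prod.mk (W ω) ⁻¹' E) ∂Q =
      Q.restrict A {ω | (W ω, Z ω) ∈ E} := by
    rw [← lintegral_map (measurable_measure_prodMk_left hE) hW0, ← Measure.prod_apply hE,
      ← (h.restrict h𝒢 hA).map_prodMk h𝒢 hW, Measure.map_apply hWZ hE]
    rfl
  simp only [measureReal_def]
  rw [integral_toReal (hmeas.mono h𝒢 le_rfl).aemeasurable (ae_of_all _ fun _ => measure_lt_top _ _),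
    hsection]
  exact (integral_indicator_one (hWZ hE)).symm

lemma condGaussian {ι : Type*} [Fintype ι] [DecidableEq ι] [IsFiniteMeasure Q]
    (h : IsStdNormalGiven 𝒢 Q Z) (h𝒢 : 𝒢 ≤ mΩ) {X a : Ω → ι → ℝ} {B : Ω → Matrix ι κ ℝ}
    {S : Ω → Matrix ι ι ℝ} (ha : Measurable[𝒢] a) (hB : Measurable[𝒢] B)
    (hS : ∀ ω, S ω = B ω * (B ω)ᵀ) (hX : ∀ ω, X ω = a ω + B ω *ᵥ Z ω) :
    CondGaussian Q 𝒢 X a S := by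
  obtain rfl : S = fun ω => B ω * (B ω)ᵀ := funext hS
  obtain rfl : X = fun ω => a ω + B ω *ᵥ Z ω := funext hX
  refine ⟨ha, measurable_matrix_mul hB (measurable_matrix_transpose hB),
    fun ω => posSemidef_mul_transpose (B ω), fun E hE => ?_⟩
  have haffine : Measurable fun q : ((ι → ℝ) × Matrix ι κ ℝ) × (κ → ℝ) =>
      WithLp.toLp 2 (q.1.1 + q.1.2 *ᵥ q.2) :=
    (WithLp.measurable_toLp 2 _).comp ((measurable_fst.comp measurable_fst).add
      (measurable_matrix_mulVec (measurable_snd.comp measurable_fst) measurable_snd))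
  refine (h.condExp_preimage h𝒢 (ha.prodMk hB) (haffine hE)).trans (ae_of_all _ fun ω => ?_)
  simp only [← stdNormal_map_affine]
  exact (map_measureReal_apply (haffine.comp (measurable_prodMk_left (x := (a ω, B ω)))) hE).symm

lemma chain [IsFiniteMeasure Q] {ℱ : ℤ → MeasurableSpace Ω} (hmono : Monotone ℱ)
    (hℱ : ∀ t, ℱ t ≤ mΩ) {Z : ℤ → Ω → κ → ℝ} {a b : ℤ} (hab : a ≤ b)
    (hmeas : ∀ t ∈ Finset.Icc (a + 1) b, Measurable[ℱ t] (Z t))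
    (h : ∀ t ∈ Finset.Icc (a + 1) b, IsStdNormalGiven (ℱ (t - 1)) Q (Z t)) :
    IsStdNormalGiven (ℱ a) Q fun ω (r : Times (a + 1) b × κ) => Z r.1 ω r.2 := by
  induction b, hab using Int.leInduction with
  | base =>
    have : IsEmpty (Times (a + 1) a) := ⟨fun t => by
      have := Finset.mem_Icc.1 t.2
      omega⟩
    exact of_isEmpty _
  | succ b hab ih =>
    have hsub : Finset.Icc (a + 1) b ⊆ Finset.Icc (a + 1) (b + 1) :=
      Finset.Icc_subset_Icc_right (by omega)
    have hpast := ih (fun t ht => hmeas t (hsub ht)) fun t ht => h t (hsub ht)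
    have hnext : IsStdNormalGiven (ℱ b) Q (Z (b + 1)) := by
      simpa using h (b + 1) (Finset.mem_Icc.2 (by omega))
    have hpast_meas : Measurable[ℱ b] fun ω (r : Times (a + 1) b × κ) => Z r.1 ω r.2 :=
      @measurable_pi_lambda _ _ _ (ℱ b) _ _ fun r => (measurable_pi_apply r.2).comp
        ((hmeas _ (hsub r.1.2)).mono (hmono (Finset.mem_Icc.1 r.1.2).2) le_rfl)
    obtain ⟨e, he⟩ := exists_equiv_times_succ κ hab
    rw [funext₂ fun ω r => (he (fun t => Z t ω) r).symm]
    exact (hpast.sumElim (hmono hab) (hℱ b) hpast_meas hnext).comp_injective e.injective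

end IsStdNormalGiven

section CameronMartin

variable {κ : Type*} [Fintype κ]

lemma lintegral_prod_pi {X : κ → Type*} [∀ i, MeasurableSpace (X i)] {μ : ∀ i, Measure (X i)}
    [∀ i, IsProbabilityMeasure (μ i)] {f : ∀ i, X i → ENNReal} (hf : ∀ i, Measurable (f i)) :
    ∫⁻ z, ∏ i, f i (z i) ∂Measure.pi μ = ∏ i, ∫⁻ x, f i x ∂μ i := by
  refine (lintegral_prod_eq_prod_lintegral_of_indepFun Finset.univ
    (fun i (z : ∀ i, X i) => f i (z i))
    (iIndepFun_pi (X := f) fun i => (hf i).aemeasurable)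
    fun i => (hf i).comp (measurable_pi_apply i)).trans ?_
  exact Finset.prod_congr rfl fun i _ => (measurePreserving_eval μ i).lintegral_comp (hf i)

lemma pi_withDensity_prod {X : κ → Type*} [∀ i, MeasurableSpace (X i)] {μ : ∀ i, Measure (X i)}
    [∀ i, IsProbabilityMeasure (μ i)] {f : ∀ i, X i → ENNReal} (hf : ∀ i, Measurable (f i))
    [∀ i, SigmaFinite ((μ i).withDensity (f i))] :
    (Measure.pi μ).withDensity (fun z => ∏ i, f i (z i)) =
      Measure.pi fun i => (μ i).withDensity (f i) := by
  refine (Measure.pi_eq fun s hs => ?_).symm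
  have hbox : ∀ z : ∀ i, X i, (Set.univ.pi s).indicator (fun z => ∏ i, f i (z i)) z =
      ∏ i, (s i).indicator (f i) (z i) := fun z => by
    classical
    simp only [Set.indicator_apply, Set.mem_univ_pi, Finset.prod_ite_zero, Finset.mem_univ,
      true_implies]
  rw [withDensity_apply _ (.univ_pi hs), ← lintegral_indicator (.univ_pi hs), lintegral_congr hbox,
    lintegral_prod_pi fun i => (hf i).indicator (hs i)]
  exact Finset.prod_congr rfl fun i _ => by
    rw [lintegral_indicator (hs i), withDensity_apply _ (hs i)]

lemma gaussianReal_zero_one_withDensity (η : ℝ) :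
    (gaussianReal 0 1).withDensity
      (fun x => ENNReal.ofReal (Real.exp (η * x - 1 / 2 * (η * η)))) = gaussianReal η 1 := by
  rw [gaussianReal_of_var_ne_zero 0 one_ne_zero, gaussianReal_of_var_ne_zero η one_ne_zero,
    ← withDensity_mul _ (measurable_gaussianPDF 0 1) (by fun_prop)]
  congr 1 with x
  rw [Pi.mul_apply, gaussianPDF, gaussianPDF, ← ENNReal.ofReal_mul (gaussianPDFReal_nonneg _ _ _),
    gaussianPDFReal, gaussianPDFReal, mul_assoc, ← Real.exp_add]
  congr 3
  simp only [NNReal.coe_one]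
  ring

/-- The Cameron–Martin density of `N(η, I)` with respect to `N(0, I)` at the point `z`. -/
noncomputable def cameronMartinDensity (η z : κ → ℝ) : ℝ :=
  Real.exp (η ⬝ᵥ z - 1 / 2 * (η ⬝ᵥ η))

lemma measurable_cameronMartinDensity {Ω : Type*} {m : MeasurableSpace Ω} {η z : Ω → κ → ℝ}
    (hη : Measurable η) (hz : Measurable z) :
    Measurable fun ω => cameronMartinDensity (η ω) (z ω) :=
  ((measurable_dotProduct hη hz).sub ((measurable_dotProduct hη hη).const_mul _)).exp

lemma ofReal_cameronMartinDensity_eq_prod (η z : κ → ℝ) :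
    ENNReal.ofReal (cameronMartinDensity η z) =
      ∏ i, ENNReal.ofReal (Real.exp (η i * z i - 1 / 2 * (η i * η i))) := by
  rw [← ENNReal.ofReal_prod_of_nonneg fun i _ => (Real.exp_pos _).le, ← Real.exp_sum,
    Finset.sum_sub_distrib, ← Finset.mul_sum]
  rfl

lemma stdNormal_withDensity_cameronMartinDensity (η : κ → ℝ) :
    (stdNormal κ).withDensity (fun z => ENNReal.ofReal (cameronMartinDensity η z)) =
      (stdNormal κ).map (· + η) := by
  let f : κ → ℝ → ENNReal := fun i x => ENNReal.ofReal (Real.exp (η i * x - 1 / 2 * (η i * η i)))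
  have hf : ∀ i, Measurable (f i) := fun i => by fun_prop
  have hfactor : ∀ i, (gaussianReal 0 1).withDensity (f i) = (gaussianReal 0 1).map (· + η i) :=
    fun i => by
      rw [gaussianReal_zero_one_withDensity, gaussianReal_map_add_const, zero_add]
  have (i : κ) : IsProbabilityMeasure ((gaussianReal 0 1).map (· + η i)) :=
    Measure.isProbabilityMeasure_map (by fun_prop)
  have hdensity : ∀ i, SigmaFinite ((gaussianReal 0 1).withDensity (f i)) := fun i => by
    rw [hfactor i]
    infer_instance
  simp only [ofReal_cameronMartinDensity_eq_prod]
  calc (stdNormal κ).withDensity (fun z => ∏ i, f i (z i))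
      = Measure.pi fun i => (gaussianReal 0 1).map (· + η i) := by
        rw [stdNormal, pi_withDensity_prod hf, funext hfactor]
    _ = (stdNormal κ).map (· + η) := (Measure.pi_map_pi fun i => by fun_prop).symm

lemma lintegral_cameronMartinDensity_mul (η : κ → ℝ) {f : (κ → ℝ) → ENNReal}
    (hf : Measurable f) :
    ∫⁻ z, ENNReal.ofReal (cameronMartinDensity η z) * f (z - η) ∂stdNormal κ =
      ∫⁻ z, f z ∂stdNormal κ := by
  have hdensity := (measurable_cameronMartinDensity (measurable_const (a := η))
    measurable_id').ennreal_ofReal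
  have hshift : Measurable fun z => f (z - η) := hf.comp (measurable_id'.sub_const η)
  calc ∫⁻ z, ENNReal.ofReal (cameronMartinDensity η z) * f (z - η) ∂stdNormal κ
      = ∫⁻ z, f (z - η) ∂(stdNormal κ).map (· + η) := by
        rw [← stdNormal_withDensity_cameronMartinDensity,
          lintegral_withDensity_eq_lintegral_mul _ hdensity hshift]
        rfl
    _ = ∫⁻ z, f z ∂stdNormal κ := by
        rw [lintegral_map hshift (measurable_id'.add_const η)]
        simp only [add_sub_cancel_right]

lemma IsStdNormalGiven.lintegral_girsanov {Ω : Type*} {𝒢 mΩ : MeasurableSpace Ω}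
    {μ : Measure Ω} [IsFiniteMeasure μ] {Z : Ω → κ → ℝ} (h : IsStdNormalGiven 𝒢 μ Z)
    (h𝒢 : 𝒢 ≤ mΩ) {η : Ω → κ → ℝ} (hη : Measurable[𝒢] η) {g : Ω → ENNReal}
    (hg : Measurable[𝒢] g) {f : (κ → ℝ) → ENNReal} (hf : Measurable f) :
    ∫⁻ ω, g ω * (ENNReal.ofReal (cameronMartinDensity (η ω) (Z ω)) * f (Z ω - η ω)) ∂μ =
      (∫⁻ ω, g ω ∂μ) * ∫⁻ z, f z ∂stdNormal κ := by
  let tilted : (κ → ℝ) × (κ → ℝ) → ENNReal := fun q =>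
    ENNReal.ofReal (cameronMartinDensity q.1 q.2) * f (q.2 - q.1)
  have htilted : Measurable tilted :=
    (measurable_cameronMartinDensity measurable_fst measurable_snd).ennreal_ofReal.mul
      (hf.comp (measurable_snd.sub measurable_fst))
  have hintegrand : Measurable fun q : (ENNReal × (κ → ℝ)) × (κ → ℝ) =>
      q.1.1 * tilted (q.1.2, q.2) := by
    fun_prop
  calc ∫⁻ ω, g ω * tilted (η ω, Z ω) ∂μ
      = ∫⁻ ω, ∫⁻ z, g ω * tilted (η ω, z) ∂stdNormal κ ∂μ :=
        h.lintegral_eq h𝒢 (hg.prodMk hη) hintegrand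
    _ = ∫⁻ ω, g ω * ∫⁻ z, f z ∂stdNormal κ ∂μ := lintegral_congr fun ω => by
        rw [lintegral_const_mul _ (by fun_prop)]
        exact congrArg (g ω * ·) (lintegral_cameronMartinDensity_mul (η ω) hf)
    _ = (∫⁻ ω, g ω ∂μ) * ∫⁻ z, f z ∂stdNormal κ :=
        lintegral_mul_const _ (hg.mono h𝒢 le_rfl)

end CameronMartin

lemma measurable_apply_countable {Ω ι β : Type*} {m : MeasurableSpace Ω} [MeasurableSpace ι]
    [Countable ι] [MeasurableSingletonClass ι] [MeasurableSpace β] {f : ι → Ω → β} {s : Ω → ι}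
    (hf : ∀ i, Measurable (f i)) (hs : Measurable s) : Measurable fun ω => f (s ω) ω :=
  (measurable_from_prod_countable_right (f := fun q : ι × Ω => f q.1 q.2) hf).comp
    (hs.prodMk measurable_id)

namespace MSVAR

variable {Ω : Type*} {n k p T N n' k' p' q' Tpast : ℕ}

section Information

variable (M : MSVAR Ω n k p T N n' k' p' q' Tpast)

lemma F0_le_H (t : ℤ) : M.F0 ≤ M.H t :=
  le_sup_of_le_left (le_sup_of_le_left (le_sup_of_le_left le_sup_left))

lemma sigmaCoeff_le_H (t : ℤ) : M.sigmaCoeff ≤ M.H t :=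
  le_sup_of_le_left (le_sup_of_le_left le_sup_right)

lemma sigmaTrans_le_H (t : ℤ) : M.sigmaTrans ≤ M.H t := le_sup_of_le_left le_sup_right

lemma sigmaRegimes_le_H (t : ℤ) : M.sigmaRegimes T ≤ M.H t := le_sup_right

lemma comap_y_le_H {t u : ℤ} (hu : u ∈ Finset.Icc 1 t) :
    MeasurableSpace.comap (M.y u) inferInstance ≤ M.H t :=
  le_sup_of_le_left (le_sup_of_le_left (le_sup_of_le_left (le_sup_of_le_right
    (le_iSup₂_of_le u hu le_rfl))))

lemma monotone_H : Monotone M.H := fun _ _ h =>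
  sup_le_sup_right (sup_le_sup_right (sup_le_sup_right (sup_le_sup_left
    (biSup_mono fun _ hu => Finset.Icc_subset_Icc_right h hu) _) _) _) _

lemma H_zero_le : M.H 0 ≤ M.F0 ⊔ (M.sigmaCoeff ⊔ M.sigmaTrans ⊔ M.sigmaRegimes T) := by
  refine sup_le (sup_le (sup_le (sup_le le_sup_left (iSup₂_le fun u hu => ?_)) ?_) ?_) ?_
  · have := Finset.mem_Icc.1 hu
    omega
  · exact le_sup_of_le_right (le_sup_of_le_left le_sup_left)
  · exact le_sup_of_le_right (le_sup_of_le_left le_sup_right)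
  · exact le_sup_of_le_right le_sup_right

lemma H_succ_le (t : ℤ) :
    M.H (t + 1) ≤ M.H t ⊔ MeasurableSpace.comap (M.y (t + 1)) inferInstance := by
  refine sup_le (sup_le (sup_le (sup_le ?_ (iSup₂_le fun u hu => ?_)) ?_) ?_) ?_
  · exact le_sup_of_le_left (M.F0_le_H t)
  · obtain ⟨hu₁, hu⟩ := Finset.mem_Icc.1 hu
    obtain rfl | hlt := hu.eq_or_lt
    · exact le_sup_right
    · exact le_sup_of_le_left (M.comap_y_le_H (Finset.mem_Icc.2 (by omega)))
  · exact le_sup_of_le_left (M.sigmaCoeff_le_H t)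
  · exact le_sup_of_le_left (M.sigmaTrans_le_H t)
  · exact le_sup_of_le_left (M.sigmaRegimes_le_H t)

lemma measurable_y_H {t u : ℤ} (hu : 1 - (p : ℤ) ≤ u) (hut : u ≤ t) :
    Measurable[M.H t] (M.y u) := by
  rw [measurable_iff_comap_le]
  obtain hu₀ | hu₁ := le_or_gt u 0
  · exact le_trans (le_sup_of_le_left (le_sup_of_le_left
      (le_iSup₂_of_le u (Finset.mem_Icc.2 (by omega)) le_rfl))) (M.F0_le_H t)
  · exact M.comap_y_le_H (Finset.mem_Icc.2 ⟨hu₁, hut⟩)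

lemma measurable_psi_H (t : ℤ) {u : ℤ} (hu : u ∈ Finset.Icc (1 : ℤ) T) :
    Measurable[M.H t] (M.psi u) := by
  rw [measurable_iff_comap_le]
  have := Finset.mem_Icc.1 hu
  exact le_trans (le_sup_of_le_left (le_sup_of_le_right
    (le_iSup₂_of_le u (Finset.mem_Icc.2 (by omega)) le_rfl))) (M.F0_le_H t)

lemma measurable_s_sigmaRegimes {u : ℤ} (hu : u ∈ Finset.Icc (1 : ℤ) T) :
    Measurable[M.sigmaRegimes T] (M.s u) := by
  rw [measurable_iff_comap_le]
  exact le_iSup₂_of_le u hu le_rfl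

lemma measurable_Pi_sigmaCoeff (j : Fin N) : Measurable[M.sigmaCoeff] (M.Pi j) := by
  rw [measurable_iff_comap_le]
  exact le_sup_of_le_left (le_iSup_of_le j le_rfl)

lemma measurable_Gam_sigmaCoeff (j : Fin N) : Measurable[M.sigmaCoeff] (M.Gam j) := by
  rw [measurable_iff_comap_le]
  exact le_sup_of_le_right (le_iSup_of_le j le_rfl)

lemma measurable_PiAt_H (t : ℤ) {u : ℤ} (hu : u ∈ Finset.Icc (1 : ℤ) T) :
    Measurable[M.H t] (M.PiAt u) :=
  measurable_apply_countable (f := M.Pi) (s := M.s u)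
    (fun j => (M.measurable_Pi_sigmaCoeff j).mono (M.sigmaCoeff_le_H t) le_rfl)
    ((M.measurable_s_sigmaRegimes hu).mono (M.sigmaRegimes_le_H t) le_rfl)

lemma measurable_GamAt_H (t : ℤ) {u : ℤ} (hu : u ∈ Finset.Icc (1 : ℤ) T) :
    Measurable[M.H t] (M.GamAt u) :=
  measurable_apply_countable (f := M.Gam) (s := M.s u)
    (fun j => (M.measurable_Gam_sigmaCoeff j).mono (M.sigmaCoeff_le_H t) le_rfl)
    ((M.measurable_s_sigmaRegimes hu).mono (M.sigmaRegimes_le_H t) le_rfl)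

lemma measurable_lagged_H {t : ℤ} (ht : t ∈ Finset.Icc (1 : ℤ) T) :
    Measurable[M.H (t - 1)] (M.lagged t) := by
  have hcoord : ∀ c, Measurable[M.H (t - 1)] fun ω => M.lagged t ω c := by
    rintro (c | ⟨l, i⟩)
    · exact (measurable_pi_apply c).comp (M.measurable_psi_H (t - 1) ht)
    · have := Finset.mem_Icc.1 ht
      have := l.2
      exact (measurable_pi_apply i).comp (M.measurable_y_H (by omega) (by omega))
  exact @measurable_pi_lambda _ _ _ (M.H (t - 1)) _ _ hcoord

lemma measurable_mean_H {t : ℤ} (ht : t ∈ Finset.Icc (1 : ℤ) T) :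
    Measurable[M.H (t - 1)] fun ω => M.PiAt t ω *ᵥ M.lagged t ω :=
  measurable_matrix_mulVec (M.measurable_PiAt_H _ ht) (M.measurable_lagged_H ht)

lemma IBefore_le_H {t : ℤ} (ht : t ∈ Finset.Icc (1 : ℤ) T) : M.IBefore t ≤ M.H (t - 1) := by
  have hsub : ∀ u ∈ Finset.Icc (1 : ℤ) t, u ∈ Finset.Icc (1 : ℤ) T := fun u hu =>
    Finset.Icc_subset_Icc_right (Finset.mem_Icc.1 ht).2 hu
  refine sup_le (sup_le (sup_le (sup_le ?_ ?_) ?_) ?_) ?_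
  · exact le_sup_of_le_left (le_sup_of_le_left le_sup_left)
  · exact iSup₂_le fun u hu => (M.measurable_PiAt_H _ (hsub u hu)).comap_le
  · exact iSup₂_le fun u hu => (M.measurable_GamAt_H _ (hsub u hu)).comap_le
  · exact M.sigmaTrans_le_H _
  · exact le_trans (biSup_mono hsub) (M.sigmaRegimes_le_H _)

end Information

/-- A VAR process with regimes of arbitrary dynamics: compared with `IsModel`, the process `s` need
not be a Markov chain, the matrix `trans` need not be stochastic and only enters through the
conditional independence assumptions, and `Σ_t` may depend on all of `𝓗_{t-1}`, including the
regimes after time `t`. -/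
structure IsRegimeSwitching (M : MSVAR Ω n k p T N n' k' p' q' Tpast) [mΩ : MeasurableSpace Ω]
    (μ : Measure Ω) : Prop where
  measurable_y : ∀ t, Measurable (M.y t)
  measurable_psi : ∀ t, Measurable (M.psi t)
  measurable_Sig : ∀ t, Measurable (M.Sig t)
  measurable_eps : ∀ t, Measurable (M.eps t)
  measurable_s : ∀ t, Measurable (M.s t)
  measurable_trans : Measurable M.trans
  measurable_Pi : ∀ j, Measurable (M.Pi j)
  measurable_Gam : ∀ j, Measurable (M.Gam j)
  equation : ∀ t ∈ Finset.Icc (1 : ℤ) T, ∀ ω,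
    M.y t ω = M.PiAt t ω *ᵥ M.lagged t ω + M.xi t ω
  predictable : ∀ t ∈ Finset.Icc (1 : ℤ) T, Measurable[M.H (t - 1)] (M.Sig t)
  cholesky : ∀ t ∈ Finset.Icc (1 : ℤ) T, ∀ ω, IsCholeskyFactor (M.chol t ω) (M.Sig t ω)
  noise_law : ∀ t ∈ Finset.Icc (1 : ℤ) T,
    HasLaw (fun ω => WithLp.toLp 2 (M.eps t ω)) (multivariateGaussian 0 1) μ
  noise_indep : iIndepFun (fun (t : Times 1 T) => M.eps t) μ
  noise_indep_init : Indep M.sigmaNoise M.F0 μ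
  noise_condIndep : CondIndepFields μ M.F0 M.sigmaNoise
    (M.sigmaCoeff ⊔ M.sigmaTrans ⊔ M.sigmaRegimes T)
  trans_condIndep : CondIndepFields μ (M.F0 ⊔ M.sigmaRegimes T) M.sigmaTrans M.sigmaCoeff

variable {M : MSVAR Ω n k p T N n' k' p' q' Tpast} {𝒢 mΩ : MeasurableSpace Ω}
  {μ : Measure Ω}

lemma IsModel.isRegimeSwitching (hM : M.IsModel μ) : M.IsRegimeSwitching μ :=
  { hM with predictable := fun t ht => (hM.predictable t ht).mono (M.IBefore_le_H ht) le_rfl }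

namespace IsRegimeSwitching

lemma F0_le (hM : M.IsRegimeSwitching μ) : M.F0 ≤ mΩ :=
  sup_le (sup_le (iSup₂_le fun u _ => (hM.measurable_y u).comap_le)
    (iSup₂_le fun u _ => (hM.measurable_psi u).comap_le))
    (iSup₂_le fun u _ => (hM.measurable_Sig u).comap_le)

lemma sigmaCoeff_le (hM : M.IsRegimeSwitching μ) : M.sigmaCoeff ≤ mΩ :=
  sup_le (iSup_le fun j => (hM.measurable_Pi j).comap_le)
    (iSup_le fun j => (hM.measurable_Gam j).comap_le)

lemma sigmaTrans_le (hM : M.IsRegimeSwitching μ) : M.sigmaTrans ≤ mΩ :=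
  hM.measurable_trans.comap_le

lemma sigmaRegimes_le (hM : M.IsRegimeSwitching μ) (t : ℤ) : M.sigmaRegimes t ≤ mΩ :=
  iSup₂_le fun u _ => (hM.measurable_s u).comap_le

lemma sigmaNoise_le (hM : M.IsRegimeSwitching μ) : M.sigmaNoise ≤ mΩ :=
  iSup₂_le fun u _ => (hM.measurable_eps u).comap_le

lemma H_le (hM : M.IsRegimeSwitching μ) (t : ℤ) : M.H t ≤ mΩ :=
  sup_le (sup_le (sup_le (sup_le hM.F0_le (iSup₂_le fun u _ => (hM.measurable_y u).comap_le))
    hM.sigmaCoeff_le) hM.sigmaTrans_le) (hM.sigmaRegimes_le T)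

lemma isUnit_det_chol (hM : M.IsRegimeSwitching μ) {t : ℤ} (ht : t ∈ Finset.Icc (1 : ℤ) T)
    (ω : Ω) : IsUnit (M.chol t ω).det :=
  (hM.cholesky t ht ω).isUnit_det

lemma measurable_chol (hM : M.IsRegimeSwitching μ) {t : ℤ}
    (ht : t ∈ Finset.Icc (1 : ℤ) T) (h : Measurable[𝒢] (M.Sig t)) : Measurable[𝒢] (M.chol t) :=
  IsCholeskyFactor.measurable (hM.cholesky t ht) h

lemma measurable_chol_H (hM : M.IsRegimeSwitching μ) {t : ℤ} (ht : t ∈ Finset.Icc (1 : ℤ) T) :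
    Measurable[M.H (t - 1)] (M.chol t) :=
  hM.measurable_chol ht (hM.predictable t ht)

lemma measurable_y_of_measurable_eps (hM : M.IsRegimeSwitching μ) {t : ℤ}
    (ht : t ∈ Finset.Icc (1 : ℤ) T) (hle : M.H (t - 1) ≤ 𝒢) (h : Measurable[𝒢] (M.eps t)) :
    Measurable[𝒢] (M.y t) := by
  have hy : M.y t = fun ω => M.PiAt t ω *ᵥ M.lagged t ω + M.chol t ω *ᵥ M.eps t ω :=
    funext fun ω => hM.equation t ht ω
  rw [hy]
  exact ((M.measurable_mean_H ht).mono hle le_rfl).add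
    (measurable_matrix_mulVec ((hM.measurable_chol_H ht).mono hle le_rfl) h)

lemma measurable_eps_H (hM : M.IsRegimeSwitching μ) {t : ℤ} (ht : t ∈ Finset.Icc (1 : ℤ) T) :
    Measurable[M.H t] (M.eps t) := by
  have hle := M.monotone_H (sub_le_self t zero_le_one)
  have hy : Measurable[M.H t] (M.y t) := by
    have := Finset.mem_Icc.1 ht
    exact M.measurable_y_H (by omega) le_rfl
  have heps : M.eps t = fun ω => (M.chol t ω)⁻¹ *ᵥ (M.y t ω - M.PiAt t ω *ᵥ M.lagged t ω) := by
    ext1 ω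
    rw [hM.equation t ht ω, add_sub_cancel_left, xi, mulVec_mulVec,
      nonsing_inv_mul _ (hM.isUnit_det_chol ht ω), one_mulVec]
  rw [heps]
  exact measurable_matrix_mulVec
    (measurable_matrix_inv ((hM.measurable_chol_H ht).mono hle le_rfl))
    (hy.sub ((M.measurable_mean_H ht).mono hle le_rfl))

end IsRegimeSwitching

section Noise

/-- `σ(ε_1, …, ε_t)`. -/
@[reducible] def noiseUpTo (M : MSVAR Ω n k p T N n' k' p' q' Tpast) (t : ℤ) :
    MeasurableSpace Ω :=
  ⨆ u ∈ Finset.Icc (1 : ℤ) t, MeasurableSpace.comap (M.eps u) inferInstance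

lemma monotone_noiseUpTo : Monotone M.noiseUpTo := fun _ _ h =>
  biSup_mono fun _ hu => Finset.Icc_subset_Icc_right h hu

lemma comap_eps_le_noiseUpTo {t u : ℤ} (hu : u ∈ Finset.Icc 1 t) :
    MeasurableSpace.comap (M.eps u) inferInstance ≤ M.noiseUpTo t :=
  le_iSup₂_of_le u hu le_rfl

namespace IsRegimeSwitching

lemma H_le_noiseUpTo_sup (hM : M.IsRegimeSwitching μ) {t : ℤ} (ht₀ : 0 ≤ t) (htT : t ≤ T) :
    M.H t ≤ M.noiseUpTo t ⊔ M.H 0 := by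
  induction t, ht₀ using Int.leInduction with
  | base => exact le_sup_right
  | succ t ht₀ ih =>
    have hmem : t + 1 ∈ Finset.Icc (1 : ℤ) T := Finset.mem_Icc.2 (by omega)
    have hprev : M.H t ≤ M.noiseUpTo (t + 1) ⊔ M.H 0 :=
      (ih (by omega)).trans (sup_le_sup_right (monotone_noiseUpTo (by omega)) _)
    have heps : Measurable[M.noiseUpTo (t + 1) ⊔ M.H 0] (M.eps (t + 1)) := by
      rw [measurable_iff_comap_le]
      exact le_sup_of_le_left (comap_eps_le_noiseUpTo (Finset.mem_Icc.2 (by omega)))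
    refine (M.H_succ_le t).trans (sup_le hprev ?_)
    exact (hM.measurable_y_of_measurable_eps hmem (by rwa [add_sub_cancel_right]) heps).comap_le

lemma indep_sigmaNoise_H_zero [IsFiniteMeasure μ] (hM : M.IsRegimeSwitching μ) :
    Indep M.sigmaNoise (M.H 0) μ :=
  indep_of_indep_of_le_right (hM.noise_condIndep.indep_sup hM.F0_le hM.sigmaNoise_le
    (sup_le (sup_le hM.sigmaCoeff_le hM.sigmaTrans_le) (hM.sigmaRegimes_le T))
    hM.noise_indep_init) M.H_zero_le

lemma indep_comap_eps_noiseUpTo (hM : M.IsRegimeSwitching μ) {t : ℤ}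
    (ht : t ∈ Finset.Icc (1 : ℤ) T) :
    Indep (MeasurableSpace.comap (M.eps t) inferInstance) (M.noiseUpTo (t - 1)) μ := by
  let now : Times 1 T := ⟨t, ht⟩
  have hdisj := indep_iSup_of_disjoint (fun u : Times 1 T => (hM.measurable_eps u).comap_le)
    hM.noise_indep.iIndep (S := {now}) (T := {now}ᶜ) disjoint_compl_right
  refine indep_of_indep_of_le_left (indep_of_indep_of_le_right hdisj ?_) ?_
  · refine iSup₂_le fun u hu => ?_
    rw [Finset.mem_Icc] at hu ht
    have hne : (⟨u, Finset.mem_Icc.2 (by omega)⟩ : Times 1 T) ∈ ({now}ᶜ : Set (Times 1 T)) :=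
      fun h => by
        have : u = t := congrArg Subtype.val h
        omega
    exact le_biSup (fun u : Times 1 T => MeasurableSpace.comap (M.eps u) inferInstance) hne
  · exact le_biSup (fun u : Times 1 T => MeasurableSpace.comap (M.eps u) inferInstance)
      (Set.mem_singleton now)

lemma isStdNormalGiven_eps [IsProbabilityMeasure μ] (hM : M.IsRegimeSwitching μ) {t : ℤ}
    (ht : t ∈ Finset.Icc (1 : ℤ) T) : IsStdNormalGiven (M.H (t - 1)) μ (M.eps t) := by
  have ht' := Finset.mem_Icc.1 ht
  have hcur : MeasurableSpace.comap (M.eps t) inferInstance ≤ M.sigmaNoise :=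
    comap_eps_le_noiseUpTo ht
  have hpast : M.noiseUpTo (t - 1) ≤ M.sigmaNoise := monotone_noiseUpTo (by omega)
  have hindep : Indep (MeasurableSpace.comap (M.eps t) inferInstance)
      (M.noiseUpTo (t - 1) ⊔ M.H 0) μ :=
    indep_sup_right_of_indep_sup_left (hcur.trans hM.sigmaNoise_le) (hpast.trans hM.sigmaNoise_le)
      (hM.H_le 0) (hM.indep_comap_eps_noiseUpTo ht)
      (indep_of_indep_of_le_left hM.indep_sigmaNoise_H_zero (sup_le hcur hpast))
  exact .of_indep (hM.measurable_eps t)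
    (map_eq_stdNormal_of_hasLaw (hM.measurable_eps t) (hM.noise_law t ht))
    (indep_of_indep_of_le_right hindep (hM.H_le_noiseUpTo_sup (by omega) (by omega)))

end IsRegimeSwitching

end Noise

section Girsanov

/-- The standardized Girsanov kernel `η_t = Σ_t^{-1/2} θ_t`. -/
noncomputable def eta (M : MSVAR Ω n k p T N n' k' p' q' Tpast) (θ : ℤ → Ω → Fin n → ℝ) (t : ℤ)
    (ω : Ω) : Fin n → ℝ :=
  (M.chol t ω)⁻¹ *ᵥ θ t ω

/-- The white noise `ε_t - η_t` of the risk-neutral measure. -/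
noncomputable def epsTilde (M : MSVAR Ω n k p T N n' k' p' q' Tpast) (θ : ℤ → Ω → Fin n → ℝ)
    (t : ℤ) (ω : Ω) : Fin n → ℝ :=
  M.eps t ω - M.eta θ t ω

/-- `epsTilde θ`, stacked over the times `a, …, b`. -/
noncomputable def epsTildeStack (M : MSVAR Ω n k p T N n' k' p' q' Tpast)
    (θ : ℤ → Ω → Fin n → ℝ) (a b : ℤ) (ω : Ω) : Times a b × Fin n → ℝ :=
  fun r => M.epsTilde θ r.1 ω r.2

/-- The kernel `θ` is predictable: `θ_t` is `𝓗_{t-1}`-measurable for `t = 1, …, T`. It may thus look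
ahead at the regimes and the coefficients, which the smaller `σ`-field `𝓘_{t-1}` forbids. -/
def IsPredictable (M : MSVAR Ω n k p T N n' k' p' q' Tpast) (θ : ℤ → Ω → Fin n → ℝ) : Prop :=
  ∀ t ∈ Finset.Icc (1 : ℤ) T, Measurable[M.H (t - 1)] (θ t)

variable {M : MSVAR Ω n k p T N n' k' p' q' Tpast} {θ : ℤ → Ω → Fin n → ℝ}

lemma stateDensity_nonneg (t : ℤ) (ω : Ω) : 0 ≤ M.stateDensity θ t ω :=
  Finset.prod_nonneg fun _ _ => (Real.exp_pos _).le

variable {mΩ : MeasurableSpace Ω} {μ : Measure Ω}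

namespace IsRegimeSwitching

lemma chol_mulVec_eta (hM : M.IsRegimeSwitching μ) (θ : ℤ → Ω → Fin n → ℝ) {t : ℤ}
    (ht : t ∈ Finset.Icc (1 : ℤ) T) (ω : Ω) : M.chol t ω *ᵥ M.eta θ t ω = θ t ω := by
  rw [eta, mulVec_mulVec, mul_nonsing_inv _ (hM.isUnit_det_chol ht ω), one_mulVec]

lemma dotProduct_inv_Sig_mulVec_chol (hM : M.IsRegimeSwitching μ) (θ : ℤ → Ω → Fin n → ℝ) {t : ℤ}
    (ht : t ∈ Finset.Icc (1 : ℤ) T) (ω : Ω) (v : Fin n → ℝ) :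
    θ t ω ⬝ᵥ ((M.Sig t ω)⁻¹ *ᵥ (M.chol t ω *ᵥ v)) = M.eta θ t ω ⬝ᵥ v := by
  rw [← (hM.cholesky t ht ω).2.2, Matrix.mul_inv_rev, mulVec_mulVec, Matrix.mul_assoc,
    nonsing_inv_mul _ (hM.isUnit_det_chol ht ω), Matrix.mul_one, ← transpose_nonsing_inv,
    dotProduct_mulVec, vecMul_transpose, eta]

lemma stateDensity_eq_prod (hM : M.IsRegimeSwitching μ) (θ : ℤ → Ω → Fin n → ℝ) {t : ℤ}
    (ht : t ≤ T) (ω : Ω) :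
    M.stateDensity θ t ω =
      ∏ m ∈ Finset.Icc 1 t, cameronMartinDensity (M.eta θ m ω) (M.eps m ω) := by
  refine Finset.prod_congr rfl fun m hm => ?_
  have hmT : m ∈ Finset.Icc (1 : ℤ) T := Finset.Icc_subset_Icc_right ht hm
  have hquad := hM.dotProduct_inv_Sig_mulVec_chol θ hmT ω (M.eta θ m ω)
  rw [hM.chol_mulVec_eta θ hmT] at hquad
  rw [xi, hM.dotProduct_inv_Sig_mulVec_chol θ hmT, hquad, cameronMartinDensity]

lemma stateDensity_succ (hM : M.IsRegimeSwitching μ) (θ : ℤ → Ω → Fin n → ℝ) {t : ℤ}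
    (ht : t + 1 ∈ Finset.Icc (1 : ℤ) T) (ω : Ω) :
    M.stateDensity θ (t + 1) ω = M.stateDensity θ t ω *
      cameronMartinDensity (M.eta θ (t + 1) ω) (M.eps (t + 1) ω) := by
  obtain ⟨ht₁, htT⟩ := Finset.mem_Icc.1 ht
  have hIcc : Finset.Icc 1 (t + 1) = insert (t + 1) (Finset.Icc 1 t) :=
    (Finset.insert_Icc_right_eq_Icc_succ ht₁).symm
  rw [hM.stateDensity_eq_prod θ htT, hM.stateDensity_eq_prod θ (by omega), hIcc,
    Finset.prod_insert (by simp), mul_comm]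

lemma measurable_eta_H (hM : M.IsRegimeSwitching μ) (hθ : M.IsPredictable θ) {t : ℤ}
    (ht : t ∈ Finset.Icc (1 : ℤ) T) : Measurable[M.H (t - 1)] (M.eta θ t) :=
  measurable_matrix_mulVec (measurable_matrix_inv (hM.measurable_chol_H ht)) (hθ t ht)

lemma measurable_epsTilde_H (hM : M.IsRegimeSwitching μ) (hθ : M.IsPredictable θ) {t : ℤ}
    (ht : t ∈ Finset.Icc (1 : ℤ) T) : Measurable[M.H t] (M.epsTilde θ t) :=
  (hM.measurable_eps_H ht).sub
    ((hM.measurable_eta_H hθ ht).mono (M.monotone_H (sub_le_self t zero_le_one)) le_rfl)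

lemma measurable_epsTildeStack_H (hM : M.IsRegimeSwitching μ) (hθ : M.IsPredictable θ) {t : ℤ}
    (ht : t ≤ T) : Measurable[M.H t] (M.epsTildeStack θ 1 t) :=
  @measurable_pi_lambda _ _ _ (M.H t) _ _ fun r =>
    have hr := Finset.mem_Icc.1 r.1.2
    (measurable_pi_apply r.2).comp
      ((hM.measurable_epsTilde_H hθ (Finset.Icc_subset_Icc_right ht r.1.2)).mono
        (M.monotone_H hr.2) le_rfl)

lemma measurable_stateDensity_H (hM : M.IsRegimeSwitching μ) (hθ : M.IsPredictable θ) {t : ℤ}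
    (ht : t ≤ T) : Measurable[M.H t] (M.stateDensity θ t) := by
  rw [funext (hM.stateDensity_eq_prod θ ht)]
  refine Finset.measurable_prod _ fun m hm => ?_
  have hmT : m ∈ Finset.Icc (1 : ℤ) T := Finset.Icc_subset_Icc_right ht hm
  have hmt := (Finset.mem_Icc.1 hm).2
  exact measurable_cameronMartinDensity
    ((hM.measurable_eta_H hθ hmT).mono (M.monotone_H (by omega)) le_rfl)
    ((hM.measurable_eps_H hmT).mono (M.monotone_H hmt) le_rfl)

variable [IsProbabilityMeasure μ]

lemma lintegral_stateDensity_succ_mul (hM : M.IsRegimeSwitching μ) (hθ : M.IsPredictable θ) {t : ℤ}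
    (ht : t + 1 ∈ Finset.Icc (1 : ℤ) T) {g : Ω → ENNReal} (hg : Measurable[M.H t] g)
    {f : (Fin n → ℝ) → ENNReal} (hf : Measurable f) :
    ∫⁻ ω, ENNReal.ofReal (M.stateDensity θ (t + 1) ω) * (g ω * f (M.epsTilde θ (t + 1) ω)) ∂μ =
      (∫⁻ ω, ENNReal.ofReal (M.stateDensity θ t ω) * g ω ∂μ) * ∫⁻ z, f z ∂stdNormal (Fin n) := by
  have hstd := hM.isStdNormalGiven_eps ht
  have hη := hM.measurable_eta_H hθ ht
  rw [add_sub_cancel_right] at hstd hη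
  have hLg : Measurable[M.H t] fun ω => ENNReal.ofReal (M.stateDensity θ t ω) * g ω :=
    (hM.measurable_stateDensity_H hθ
      ((Int.le_add_one le_rfl).trans (Finset.mem_Icc.1 ht).2)).ennreal_ofReal.mul hg
  rw [← hstd.lintegral_girsanov (hM.H_le t) hη hLg hf]
  refine lintegral_congr fun ω => ?_
  rw [hM.stateDensity_succ θ ht, ENNReal.ofReal_mul (stateDensity_nonneg t ω), epsTilde]
  ring

lemma lintegral_stateDensity_mul (hM : M.IsRegimeSwitching μ) (hθ : M.IsPredictable θ) {t u : ℤ}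
    (ht : 0 ≤ t) (htu : t ≤ u) (hu : u ≤ T) {g : Ω → ENNReal} (hg : Measurable[M.H t] g) :
    ∫⁻ ω, ENNReal.ofReal (M.stateDensity θ u ω) * g ω ∂μ =
      ∫⁻ ω, ENNReal.ofReal (M.stateDensity θ t ω) * g ω ∂μ := by
  induction u, htu using Int.leInduction with
  | base => rfl
  | succ u htu ih =>
    rw [← ih (by omega)]
    simpa only [mul_one, lintegral_one, measure_univ] using
      hM.lintegral_stateDensity_succ_mul hθ (t := u) (Finset.mem_Icc.2 (by omega))
        (hg.mono (M.monotone_H htu) le_rfl) (f := fun _ => 1) measurable_const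

lemma lintegral_riskNeutral (hM : M.IsRegimeSwitching μ) (hθ : M.IsPredictable θ) {t : ℤ}
    (ht : t ∈ Finset.Icc (0 : ℤ) T) {g : Ω → ENNReal} (hg : Measurable[M.H t] g) :
    ∫⁻ ω, g ω ∂M.riskNeutral θ μ = ∫⁻ ω, ENNReal.ofReal (M.stateDensity θ t ω) * g ω ∂μ := by
  obtain ⟨ht₀, htT⟩ := Finset.mem_Icc.1 ht
  rw [← hM.lintegral_stateDensity_mul hθ ht₀ htT le_rfl hg]
  exact lintegral_withDensity_eq_lintegral_mul μ
    ((hM.measurable_stateDensity_H hθ le_rfl).ennreal_ofReal.mono (hM.H_le T) le_rfl)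
    (hg.mono (hM.H_le t) le_rfl)

lemma riskNeutral_apply_of_measurableSet_H_zero (hM : M.IsRegimeSwitching μ)
    (hθ : M.IsPredictable θ) {A : Set Ω} (hA : MeasurableSet[M.H 0] A) :
    M.riskNeutral θ μ A = μ A := by
  have hA0 : MeasurableSet A := hM.H_le 0 _ hA
  rw [← lintegral_indicator_one hA0, ← lintegral_indicator_one hA0,
    hM.lintegral_riskNeutral hθ (t := 0) (by simp) (measurable_indicator_one hA)]
  simp [stateDensity]

lemma isProbabilityMeasure_riskNeutral (hM : M.IsRegimeSwitching μ) (hθ : M.IsPredictable θ) :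
    IsProbabilityMeasure (M.riskNeutral θ μ) :=
  ⟨by rw [hM.riskNeutral_apply_of_measurableSet_H_zero hθ .univ, measure_univ]⟩

lemma isStdNormalGiven_epsTilde (hM : M.IsRegimeSwitching μ) (hθ : M.IsPredictable θ) {t : ℤ}
    (ht : t ∈ Finset.Icc (1 : ℤ) T) :
    IsStdNormalGiven (M.H (t - 1)) (M.riskNeutral θ μ) (M.epsTilde θ t) := by
  obtain ⟨t, rfl⟩ : ∃ u, t = u + 1 := ⟨t - 1, by omega⟩
  rw [add_sub_cancel_right]
  have ht' := Finset.mem_Icc.1 ht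
  have hZ := hM.measurable_epsTilde_H hθ ht
  have hZ0 : Measurable (M.epsTilde θ (t + 1)) := hZ.mono (hM.H_le _) le_rfl
  refine ⟨hZ0, fun A hA => Measure.ext fun E hE => ?_⟩
  have hA0 : MeasurableSet A := hM.H_le t _ hA
  have hgirsanov :
      ∫⁻ ω, A.indicator 1 ω * E.indicator 1 (M.epsTilde θ (t + 1) ω) ∂M.riskNeutral θ μ =
        (∫⁻ ω, A.indicator 1 ω ∂M.riskNeutral θ μ) *
          ∫⁻ z, E.indicator 1 z ∂stdNormal (Fin n) := by
    have hprod : Measurable[M.H (t + 1)] fun ω =>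
        A.indicator (1 : Ω → ENNReal) ω * E.indicator 1 (M.epsTilde θ (t + 1) ω) :=
      (measurable_indicator_one (M.monotone_H (by omega) _ hA)).mul
        ((measurable_indicator_one hE).comp hZ)
    rw [hM.lintegral_riskNeutral hθ (Finset.mem_Icc.2 (by omega)) hprod,
      hM.lintegral_riskNeutral hθ (Finset.mem_Icc.2 (by omega)) (measurable_indicator_one hA),
      hM.lintegral_stateDensity_succ_mul hθ ht (measurable_indicator_one hA)
        (measurable_indicator_one hE)]
  rw [lintegral_indicator_one hA0, lintegral_indicator_one hE] at hgirsanov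
  rw [Measure.map_apply hZ0 hE, Measure.restrict_apply (hZ0 hE), Set.inter_comm,
    ← lintegral_indicator_one (hA0.inter (hZ0 hE)), Set.inter_indicator_one, Measure.smul_apply,
    smul_eq_mul, ← hgirsanov]
  rfl

lemma isStdNormalGiven_epsTilde_stack (hM : M.IsRegimeSwitching μ) (hθ : M.IsPredictable θ)
    {a b : ℤ} (ha : 0 ≤ a) (hab : a ≤ b) (hb : b ≤ T) :
    IsStdNormalGiven (M.H a) (M.riskNeutral θ μ) (M.epsTildeStack θ (a + 1) b) := by
  have := hM.isProbabilityMeasure_riskNeutral hθ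
  have hsub : Finset.Icc (a + 1) b ⊆ Finset.Icc (1 : ℤ) T := Finset.Icc_subset_Icc (by omega) hb
  exact .chain M.monotone_H hM.H_le hab (fun t ht => hM.measurable_epsTilde_H hθ (hsub ht))
    fun t ht => hM.isStdNormalGiven_epsTilde hθ (hsub ht)

end IsRegimeSwitching

end Girsanov

section LinearSystem

lemma sum_Icc_eq_add_sum_lags {E : Type*} [AddCommMonoid E] {t b : ℤ} (ht : 1 ≤ t) (htb : t ≤ b)
    (p : ℕ) {f : ℤ → E} (hf : ∀ u, t < u ∨ u < t - p → f u = 0) :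
    ∑ u ∈ Finset.Icc 1 b, f u = f t +
      ∑ l : Fin p, if t - ((l : ℕ) + 1 : ℤ) ≤ 0 then 0 else f (t - ((l : ℕ) + 1 : ℤ)) := by
  set lags : Finset (Fin p) := {l | ¬ t - ((l : ℕ) + 1 : ℤ) ≤ 0} with hlags
  have hinj : Set.InjOn (fun l : Fin p => t - ((l : ℕ) + 1 : ℤ)) lags := fun l _ l' _ h => by
    simpa only [sub_right_inj, add_left_inj, Nat.cast_inj, Fin.val_inj] using h
  have hsub : lags.image (fun l : Fin p => t - ((l : ℕ) + 1 : ℤ)) ⊆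
      (Finset.Icc 1 b).erase t := by
    intro u hu
    obtain ⟨l, hl, rfl⟩ := Finset.mem_image.1 hu
    have hl' := (Finset.mem_filter.1 hl).2
    simp only [Finset.mem_erase, Finset.mem_Icc]
    omega
  have hzero : ∀ u ∈ (Finset.Icc 1 b).erase t,
      u ∉ lags.image (fun l : Fin p => t - ((l : ℕ) + 1 : ℤ)) → f u = 0 := by
    intro u hu hu'
    simp only [Finset.mem_erase, Finset.mem_Icc] at hu
    refine hf u (or_iff_not_imp_left.2 fun htu => lt_of_not_ge fun hpu => hu' ?_)
    refine Finset.mem_image.2 ⟨⟨(t - u - 1).toNat, by omega⟩, ?_, by grind⟩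
    simp only [hlags, Finset.mem_filter, Finset.mem_univ, true_and]
    omega
  rw [← Finset.add_sum_erase _ _ (Finset.mem_Icc.2 ⟨ht, htb⟩), ← Finset.sum_subset hsub hzero,
    Finset.sum_image hinj, hlags, Finset.sum_filter]
  simp only [ite_not]

/-- `diag(Σ_a^{1/2}, …, Σ_b^{1/2})`; the swap puts the block index first, as in `SigDiag`. -/
noncomputable def cholDiag (M : MSVAR Ω n k p T N n' k' p' q' Tpast) (a b : ℤ) (ω : Ω) :
    Matrix (Times a b × Fin n) (Times a b × Fin n) ℝ :=
  (blockDiagonal fun t : Times a b => M.chol t ω).submatrix Prod.swap Prod.swap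

/-- The kernel `θ` is linear in the lags: `θ_t = Δ_t Y_{t-1}` for `t = 1, …, T`. -/
def IsLinearInLags (M : MSVAR Ω n k p T N n' k' p' q' Tpast) (θ : ℤ → Ω → Fin n → ℝ)
    (Δ : ℤ → Ω → Matrix (Fin n) (Cols k p n) ℝ) : Prop :=
  ∀ t ∈ Finset.Icc (1 : ℤ) T, ∀ ω, θ t ω = Δ t ω *ᵥ M.lagged t ω

variable (M : MSVAR Ω n k p T N n' k' p' q' Tpast) (Δ : ℤ → Ω → Matrix (Fin n) (Cols k p n) ℝ)
  (ω : Ω)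

lemma cholDiag_mulVec (a b : ℤ) (v : ℤ → Fin n → ℝ) (r : Times a b × Fin n) :
    (M.cholDiag a b ω *ᵥ fun q => v q.1 q.2) r = (M.chol r.1 ω *ᵥ v r.1) r.2 := by
  simp only [cholDiag, mulVec, dotProduct, submatrix_apply, blockDiagonal_apply, Prod.fst_swap,
    Prod.snd_swap, Fintype.sum_prod_type, ite_mul, zero_mul, Finset.sum_ite_irrel,
    Finset.sum_const_zero, Finset.sum_ite_eq, Finset.mem_univ, if_true]

lemma Psi_mulVec (a b c d : ℤ) (v : ℤ → Fin n → ℝ) (r : Times a b × Fin n) :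
    (M.Psi Δ a b c d ω *ᵥ fun q => v q.1 q.2) r =
      (∑ u ∈ Finset.Icc c d, M.psiBlock Δ ω r.1 u *ᵥ v u) r.2 := by
  rw [Finset.sum_apply, ← Finset.sum_coe_sort]
  simp only [Psi, mulVec, dotProduct, Fintype.sum_prod_type, of_apply]

lemma psiBlock_self (t : ℤ) : M.psiBlock Δ ω t t = 1 :=
  if_pos rfl

lemma psiBlock_eq_zero {t u : ℤ} (h : t < u ∨ u < t - p) : M.psiBlock Δ ω t u = 0 := by
  rw [psiBlock, if_neg (by omega), dif_neg (by omega)]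

lemma psiBlock_lag (t : ℤ) (l : Fin p) : M.psiBlock Δ ω t (t - ((l : ℕ) + 1 : ℤ)) =
    -(M.PiAt t ω + Δ t ω).submatrix id fun j => Sum.inr (l, j) := by
  have hl := l.2
  have hindex : (t - (t - ((l : ℕ) + 1 : ℤ)) - 1).toNat = l := by omega
  rw [psiBlock, if_neg (by omega), dif_pos (by omega)]
  simp only [hindex, Fin.eta]
  rfl

lemma isUnit_det_Psi (a b : ℤ) : IsUnit (M.Psi Δ a b a b ω).det := by
  let time : Times a b × Fin n → ℤᵒᵈ := fun r => OrderDual.toDual (r.1 : ℤ)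
  have htri : (M.Psi Δ a b a b ω).BlockTriangular time := fun r q h => by
    have hlt : (r.1 : ℤ) < q.1 := h
    rw [Psi, of_apply, M.psiBlock_eq_zero Δ ω (.inl hlt), Matrix.zero_apply]
  have hdiag : ∀ t, (M.Psi Δ a b a b ω).toSquareBlock time t = 1 := by
    rintro t
    ext ⟨⟨r, i⟩, hr⟩ ⟨⟨q, j⟩, hq⟩
    obtain rfl : r = q := Subtype.ext (OrderDual.toDual.injective (hr.trans hq.symm))
    simp [toSquareBlock_def, Psi, psiBlock_self, one_apply]
  rw [htri.det, Finset.prod_eq_one fun t _ => by rw [hdiag, det_one]]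
  exact isUnit_one

lemma sum_psiBlock_mulVec_y {t b : ℤ} (ht : 1 ≤ t) (htb : t ≤ b) :
    ∑ u ∈ Finset.Icc 1 b, M.psiBlock Δ ω t u *ᵥ M.y u ω =
      M.y t ω + (M.deltaBlock Δ ω t - (M.PiAt t ω + Δ t ω) *ᵥ M.lagged t ω) := by
  have hzero : ∀ u, t < u ∨ u < t - p → M.psiBlock Δ ω t u *ᵥ M.y u ω = 0 := fun u hu => by
    rw [M.psiBlock_eq_zero Δ ω hu, zero_mulVec]
  rw [sum_Icc_eq_add_sum_lags ht htb p hzero, psiBlock_self, one_mulVec, deltaBlock, ← mulVec_sub]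
  congr 1
  ext i
  simp only [Finset.sum_apply, psiBlock_lag, mulVec, dotProduct, Pi.sub_apply, lagged,
    Fintype.sum_sum_type, Sum.elim_inl, Sum.elim_inr, sub_self, mul_zero, Finset.sum_const_zero,
    zero_add, Fintype.sum_prod_type]
  refine Finset.sum_congr rfl fun l _ => ?_
  by_cases h : t - ((l : ℕ) + 1 : ℤ) ≤ 0 <;>
    simp [h, mulVec, dotProduct, -neg_add_rev]

variable {M Δ} {mΩ : MeasurableSpace Ω} {μ : Measure Ω} {θ : ℤ → Ω → Fin n → ℝ}

namespace IsRegimeSwitching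

lemma SigDiag_eq_mul_transpose (hM : M.IsRegimeSwitching μ) {a b : ℤ} (ha : 1 ≤ a)
    (hb : b ≤ T) :
    M.SigDiag a b ω = M.cholDiag a b ω * (M.cholDiag a b ω)ᵀ := by
  have hblocks : (fun t : Times a b => M.Sig t ω) =
      fun t : Times a b => M.chol t ω * (M.chol t ω)ᵀ :=
    funext fun t => (hM.cholesky t (Finset.Icc_subset_Icc ha hb t.2) ω).2.2.symm
  have hSig : M.SigDiag a b ω =
      (blockDiagonal fun t : Times a b => M.Sig t ω).submatrix Prod.swap Prod.swap := rfl
  rw [hSig, hblocks, blockDiagonal_mul, cholDiag, transpose_submatrix, blockDiagonal_transpose]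
  exact (submatrix_mul_equiv _ _ _ (Equiv.prodComm _ _) _).symm

lemma mul_SigDiag_mul_transpose (hM : M.IsRegimeSwitching μ) {ι : Type*} {a b : ℤ} (ha : 1 ≤ a)
    (hb : b ≤ T) (C : Matrix ι (Times a b × Fin n) ℝ) :
    C * M.SigDiag a b ω * Cᵀ = (C * M.cholDiag a b ω) * (C * M.cholDiag a b ω)ᵀ := by
  rw [hM.SigDiag_eq_mul_transpose ω ha hb, transpose_mul]
  simp only [Matrix.mul_assoc]

lemma y_eq_mean_add (hM : M.IsRegimeSwitching μ) (θ : ℤ → Ω → Fin n → ℝ) {t : ℤ}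
    (ht : t ∈ Finset.Icc (1 : ℤ) T) :
    M.y t ω = M.PiAt t ω *ᵥ M.lagged t ω + θ t ω + M.chol t ω *ᵥ M.epsTilde θ t ω := by
  rw [hM.equation t ht ω, epsTilde, mulVec_sub, hM.chol_mulVec_eta θ ht, xi]
  abel

lemma sum_psiBlock_mulVec_y (hM : M.IsRegimeSwitching μ) (hlin : M.IsLinearInLags θ Δ) {t b : ℤ}
    (ht : t ∈ Finset.Icc (1 : ℤ) T) (htb : t ≤ b) :
    ∑ u ∈ Finset.Icc 1 b, M.psiBlock Δ ω t u *ᵥ M.y u ω =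
      M.deltaBlock Δ ω t + M.chol t ω *ᵥ M.epsTilde θ t ω := by
  rw [M.sum_psiBlock_mulVec_y Δ ω (Finset.mem_Icc.1 ht).1 htb, hM.y_eq_mean_add ω θ ht,
    hlin t ht ω, add_mulVec]
  abel

lemma Psi_mulVec_yStack_add (hM : M.IsRegimeSwitching μ) (hlin : M.IsLinearInLags θ Δ) {t b : ℤ}
    (ht : 0 ≤ t) (hb : b ≤ T) :
    M.Psi Δ (t + 1) b 1 t ω *ᵥ M.yStack 1 t ω +
        M.Psi Δ (t + 1) b (t + 1) b ω *ᵥ M.yStack (t + 1) b ω =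
      M.delta Δ (t + 1) b ω + M.cholDiag (t + 1) b ω *ᵥ M.epsTildeStack θ (t + 1) b ω := by
  ext r
  obtain ⟨htr, hrb⟩ := Finset.mem_Icc.1 r.1.2
  have hunion : Finset.Icc 1 t ∪ Finset.Icc (t + 1) b = Finset.Icc 1 b := by
    grind
  have hdisj : Disjoint (Finset.Icc 1 t) (Finset.Icc (t + 1) b) :=
    Finset.disjoint_left.2 fun u => by grind
  have hrow := congrFun (hM.sum_psiBlock_mulVec_y ω hlin (t := r.1) (b := b)
    (Finset.mem_Icc.2 (by omega)) hrb) r.2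
  rw [← hunion, Finset.sum_union hdisj, Pi.add_apply, Pi.add_apply] at hrow
  rw [Pi.add_apply, Pi.add_apply]
  unfold yStack epsTildeStack
  rw [M.Psi_mulVec Δ ω _ _ _ _ fun u => M.y u ω, M.Psi_mulVec Δ ω _ _ _ _ fun u => M.y u ω,
    M.cholDiag_mulVec ω _ _ fun u => M.epsTilde θ u ω, hrow, delta]

lemma yStack_future_eq (hM : M.IsRegimeSwitching μ) (hlin : M.IsLinearInLags θ Δ) {t b : ℤ}
    (ht : 0 ≤ t) (hb : b ≤ T) :
    M.yStack (t + 1) b ω = (M.Psi Δ (t + 1) b (t + 1) b ω)⁻¹ *ᵥ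
        (M.delta Δ (t + 1) b ω - M.Psi Δ (t + 1) b 1 t ω *ᵥ M.yStack 1 t ω) +
      ((M.Psi Δ (t + 1) b (t + 1) b ω)⁻¹ * M.cholDiag (t + 1) b ω) *ᵥ
        M.epsTildeStack θ (t + 1) b ω := by
  rw [← mulVec_mulVec, ← mulVec_add, sub_add_eq_add_sub,
    ← hM.Psi_mulVec_yStack_add ω hlin ht hb, add_sub_cancel_left, mulVec_mulVec,
    nonsing_inv_mul _ (M.isUnit_det_Psi Δ ω _ _), one_mulVec]

lemma yStack_eq (hM : M.IsRegimeSwitching μ) (hlin : M.IsLinearInLags θ Δ) {b : ℤ}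
    (hb : b ≤ T) :
    M.yStack 1 b ω = (M.Psi Δ 1 b 1 b ω)⁻¹ *ᵥ M.delta Δ 1 b ω +
      ((M.Psi Δ 1 b 1 b ω)⁻¹ * M.cholDiag 1 b ω) *ᵥ M.epsTildeStack θ 1 b ω := by
  have : IsEmpty (Times 1 0) := ⟨fun u => by have := Finset.mem_Icc.1 u.2; omega⟩
  have hempty : M.yStack 1 0 ω = 0 := Subsingleton.elim _ _
  have hfuture := hM.yStack_future_eq ω hlin le_rfl hb
  rwa [hempty, mulVec_zero, sub_zero] at hfuture

lemma yStack_future_eq_C21 (hM : M.IsRegimeSwitching μ) (hlin : M.IsLinearInLags θ Δ) {t : ℤ}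
    (ht : 0 ≤ t) (htT : t ≤ T) :
    M.yStack (t + 1) T ω = (M.C21 Δ t ω *ᵥ M.delta Δ 1 t ω +
        (M.Psi Δ (t + 1) T (t + 1) T ω)⁻¹ *ᵥ M.delta Δ (t + 1) T ω) +
      ((M.C21 Δ t ω * M.cholDiag 1 t ω) *ᵥ M.epsTildeStack θ 1 t ω +
      ((M.Psi Δ (t + 1) T (t + 1) T ω)⁻¹ * M.cholDiag (t + 1) T ω) *ᵥ
        M.epsTildeStack θ (t + 1) T ω) := by
  rw [hM.yStack_future_eq ω hlin ht le_rfl, hM.yStack_eq ω hlin htT]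
  simp only [C21, mulVec_sub, mulVec_add, mulVec_mulVec, neg_mulVec, Matrix.mul_assoc,
    Matrix.neg_mul]
  abel

end IsRegimeSwitching

end LinearSystem

section SubBlocks

variable {M : MSVAR Ω n k p T N n' k' p' q' Tpast} {Δ : ℤ → Ω → Matrix (Fin n) (Cols k p n) ℝ}
  {a b c d a' b' c' d' : ℤ} {𝒢 mΩ : MeasurableSpace Ω} {μ : Measure Ω}

lemma measurable_Psi_of_le (ha : a ≤ a') (hb : b' ≤ b) (hc : c ≤ c') (hd : d' ≤ d)
    (h : Measurable[𝒢] (M.Psi Δ a b c d)) : Measurable[𝒢] (M.Psi Δ a' b' c' d') :=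
  measurable_matrix_of_apply fun r q => measurable_matrix_apply h
    (⟨r.1, Finset.Icc_subset_Icc ha hb r.1.2⟩, r.2) (⟨q.1, Finset.Icc_subset_Icc hc hd q.1.2⟩, q.2)

lemma measurable_delta_of_le (ha : a ≤ a') (hb : b' ≤ b) (h : Measurable[𝒢] (M.delta Δ a b)) :
    Measurable[𝒢] (M.delta Δ a' b') :=
  @measurable_pi_lambda _ _ _ 𝒢 _ _ fun r =>
    measurable_pi_iff.1 h (⟨r.1, Finset.Icc_subset_Icc ha hb r.1.2⟩, r.2)

lemma measurable_Sig_of_SigDiag (h : Measurable[𝒢] (M.SigDiag a b)) {t : ℤ}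
    (ht : t ∈ Finset.Icc a b) : Measurable[𝒢] (M.Sig t) :=
  measurable_matrix_of_apply fun i j => by
    simpa only [SigDiag, of_apply, if_true] using
      measurable_matrix_apply h (⟨t, ht⟩, i) (⟨t, ht⟩, j)

lemma IsRegimeSwitching.measurable_cholDiag (hM : M.IsRegimeSwitching μ) (ha : 1 ≤ a') (hb : b' ≤ T)
    (haa' : a ≤ a') (hbb' : b' ≤ b) (h : Measurable[𝒢] (M.SigDiag a b)) :
    Measurable[𝒢] (M.cholDiag a' b') := by
  refine measurable_matrix_of_apply fun r q => ?_
  simp only [cholDiag, submatrix_apply, blockDiagonal_apply]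
  split_ifs
  · exact measurable_matrix_apply (hM.measurable_chol (Finset.Icc_subset_Icc ha hb r.1.2)
      (measurable_Sig_of_SigDiag h (Finset.Icc_subset_Icc haa' hbb' r.1.2))) _ _
  · exact measurable_const

lemma measurable_yStack_H (t : ℤ) : Measurable[M.H t] (M.yStack 1 t) :=
  @measurable_pi_lambda _ _ _ (M.H t) _ _ fun r =>
    (measurable_pi_apply r.2).comp
      (M.measurable_y_H (by have := Finset.mem_Icc.1 r.1.2; omega) (Finset.mem_Icc.1 r.1.2).2)

lemma measurable_C21 {t : ℤ} (ht : t ∈ Finset.Icc (0 : ℤ) T)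
    (h : Measurable[𝒢] (M.Psi Δ 1 T 1 T)) : Measurable[𝒢] (M.C21 Δ t) := by
  obtain ⟨ht₀, htT⟩ := Finset.mem_Icc.1 ht
  have ht₁ : 1 ≤ t + 1 := by omega
  exact measurable_matrix_neg <| measurable_matrix_mul
    (measurable_matrix_mul (measurable_matrix_inv (measurable_Psi_of_le ht₁ le_rfl ht₁ le_rfl h))
      (measurable_Psi_of_le ht₁ le_rfl le_rfl htT h))
    (measurable_matrix_inv (measurable_Psi_of_le le_rfl htT le_rfl htT h))

end SubBlocks

section Conclusions

variable {M : MSVAR Ω n k p T N n' k' p' q' Tpast} {θ : ℤ → Ω → Fin n → ℝ}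
  {Δ : ℤ → Ω → Matrix (Fin n) (Cols k p n) ℝ}

lemma measurable_sVec : Measurable[M.sigmaRegimes T] M.sVec :=
  @measurable_pi_lambda _ _ _ (M.sigmaRegimes T) _ _ fun t => M.measurable_s_sigmaRegimes t.2

lemma IsLinearKernel.isPredictable (hθ : M.IsLinearKernel θ Δ) : M.IsPredictable θ :=
  fun t ht => (hθ t ht).1.mono (M.IBefore_le_H ht) le_rfl

lemma IsLinearKernel.isLinearInLags (hθ : M.IsLinearKernel θ Δ) : M.IsLinearInLags θ Δ :=
  fun t ht => (hθ t ht).2.2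

variable (M) in
lemma F0_sup_regimes_sup_trans_le_H : M.F0 ⊔ M.sigmaRegimes T ⊔ M.sigmaTrans ≤ M.H 0 :=
  sup_le (sup_le (M.F0_le_H 0) (M.sigmaRegimes_le_H 0)) (M.sigmaTrans_le_H 0)

variable {𝒢 mΩ : MeasurableSpace Ω} {μ : Measure Ω}

lemma IsRegimeSwitching.condExp_sigmaCoeff_ae_eq [IsFiniteMeasure μ]
    (hM : M.IsRegimeSwitching μ) {S : Set Ω} (hS : MeasurableSet[M.sigmaCoeff] S) :
    μ⟦S | M.F0 ⊔ M.sigmaRegimes T ⊔ M.sigmaTrans⟧ =ᵐ[μ] μ⟦S | M.F0 ⊔ M.sigmaRegimes T⟧ :=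
  hM.trans_condIndep.condExp_sup_ae_eq (sup_le hM.F0_le (hM.sigmaRegimes_le T)) hM.sigmaTrans_le
    hM.sigmaCoeff_le hS

variable [IsProbabilityMeasure μ]

namespace IsRegimeSwitching

lemma condGaussian_past (hM : M.IsRegimeSwitching μ) (hθ : M.IsPredictable θ)
    (hlin : M.IsLinearInLags θ Δ) {t : ℤ} (ht : t ∈ Finset.Icc (0 : ℤ) T)
    (hPsi : Measurable[M.H 0] (M.Psi Δ 1 t 1 t))
    (hdelta : Measurable[M.H 0] (M.delta Δ 1 t)) (hSig : Measurable[M.H 0] (M.SigDiag 1 t)) :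
    CondGaussian (M.riskNeutral θ μ) (M.H 0) (M.yStack 1 t)
      (fun ω => (M.Psi Δ 1 t 1 t ω)⁻¹ *ᵥ M.delta Δ 1 t ω)
      (fun ω => (M.Psi Δ 1 t 1 t ω)⁻¹ * M.SigDiag 1 t ω * ((M.Psi Δ 1 t 1 t ω)⁻¹)ᵀ) := by
  obtain ⟨ht₀, htT⟩ := Finset.mem_Icc.1 ht
  have := hM.isProbabilityMeasure_riskNeutral hθ
  have hinv := measurable_matrix_inv hPsi
  have hB := measurable_matrix_mul hinv
    (hM.measurable_cholDiag le_rfl htT le_rfl le_rfl hSig)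
  exact (hM.isStdNormalGiven_epsTilde_stack hθ le_rfl ht₀ htT).condGaussian (hM.H_le 0)
    (measurable_matrix_mulVec hinv hdelta) hB
    (fun ω => hM.mul_SigDiag_mul_transpose ω le_rfl htT _) fun ω => hM.yStack_eq ω hlin htT

lemma condGaussian_future_initial (hM : M.IsRegimeSwitching μ) (hθ : M.IsPredictable θ)
    (hlin : M.IsLinearInLags θ Δ) {t : ℤ} (ht : t ∈ Finset.Icc (0 : ℤ) T)
    (hPsi : Measurable[M.H 0] (M.Psi Δ 1 T 1 T))
    (hdelta : Measurable[M.H 0] (M.delta Δ 1 T)) (hSig : Measurable[M.H 0] (M.SigDiag 1 T)) :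
    CondGaussian (M.riskNeutral θ μ) (M.H 0) (M.yStack (t + 1) T)
      (fun ω => M.C21 Δ t ω *ᵥ M.delta Δ 1 t ω +
        (M.Psi Δ (t + 1) T (t + 1) T ω)⁻¹ *ᵥ M.delta Δ (t + 1) T ω)
      (fun ω => M.C21 Δ t ω * M.SigDiag 1 t ω * (M.C21 Δ t ω)ᵀ +
        (M.Psi Δ (t + 1) T (t + 1) T ω)⁻¹ * M.SigDiag (t + 1) T ω *
          ((M.Psi Δ (t + 1) T (t + 1) T ω)⁻¹)ᵀ) := by
  obtain ⟨ht₀, htT⟩ := Finset.mem_Icc.1 ht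
  have ht₁ : 1 ≤ t + 1 := by omega
  have := hM.isProbabilityMeasure_riskNeutral hθ
  have hpast := hM.isStdNormalGiven_epsTilde_stack hθ le_rfl ht₀ htT
  have hfuture := hM.isStdNormalGiven_epsTilde_stack hθ ht₀ htT le_rfl
  have hC := measurable_C21 ht hPsi
  have hinv := measurable_matrix_inv (measurable_Psi_of_le ht₁ le_rfl ht₁ le_rfl hPsi)
  have hB := measurable_matrix_fromCols
    (measurable_matrix_mul hC (hM.measurable_cholDiag le_rfl htT le_rfl htT hSig))
    (measurable_matrix_mul hinv (hM.measurable_cholDiag ht₁ le_rfl ht₁ le_rfl hSig))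
  refine (hpast.sumElim (M.monotone_H ht₀) (hM.H_le t) (hM.measurable_epsTildeStack_H hθ htT)
    hfuture).condGaussian (hM.H_le 0) (Measurable.add
      (measurable_matrix_mulVec hC (measurable_delta_of_le le_rfl htT hdelta))
      (measurable_matrix_mulVec hinv (measurable_delta_of_le ht₁ le_rfl hdelta)))
    hB (fun ω => ?_) fun ω => ?_
  · rw [transpose_fromCols, fromCols_mul_fromRows, hM.mul_SigDiag_mul_transpose ω le_rfl htT,
      hM.mul_SigDiag_mul_transpose ω ht₁ le_rfl]
  · rw [fromCols_mulVec]
    exact hM.yStack_future_eq_C21 ω hlin ht₀ htT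

lemma condGaussian_future (hM : M.IsRegimeSwitching μ) (hθ : M.IsPredictable θ)
    (hlin : M.IsLinearInLags θ Δ) {t : ℤ} (ht : t ∈ Finset.Icc (0 : ℤ) T)
    (hPsi₂₁ : Measurable[M.H t] (M.Psi Δ (t + 1) T 1 t))
    (hPsi₂₂ : Measurable[M.H t] (M.Psi Δ (t + 1) T (t + 1) T))
    (hdelta : Measurable[M.H t] (M.delta Δ (t + 1) T))
    (hSig : Measurable[M.H t] (M.SigDiag (t + 1) T)) :
    CondGaussian (M.riskNeutral θ μ) (M.H t) (M.yStack (t + 1) T)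
      (fun ω => (M.Psi Δ (t + 1) T (t + 1) T ω)⁻¹ *ᵥ
        (M.delta Δ (t + 1) T ω - M.Psi Δ (t + 1) T 1 t ω *ᵥ M.yStack 1 t ω))
      (fun ω => (M.Psi Δ (t + 1) T (t + 1) T ω)⁻¹ * M.SigDiag (t + 1) T ω *
        ((M.Psi Δ (t + 1) T (t + 1) T ω)⁻¹)ᵀ) := by
  obtain ⟨ht₀, htT⟩ := Finset.mem_Icc.1 ht
  have ht₁ : 1 ≤ t + 1 := by omega
  have := hM.isProbabilityMeasure_riskNeutral hθ
  have hinv := measurable_matrix_inv hPsi₂₂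
  have hB := measurable_matrix_mul hinv
    (hM.measurable_cholDiag ht₁ le_rfl le_rfl le_rfl hSig)
  exact (hM.isStdNormalGiven_epsTilde_stack hθ ht₀ htT le_rfl).condGaussian (hM.H_le t)
    (measurable_matrix_mulVec hinv
      (hdelta.sub (measurable_matrix_mulVec hPsi₂₁ (measurable_yStack_H t)))) hB
    (fun ω => hM.mul_SigDiag_mul_transpose ω ht₁ le_rfl _)
    fun ω => hM.yStack_future_eq ω hlin ht₀ le_rfl

lemma condGaussian_step (hM : M.IsRegimeSwitching μ) (hθ : M.IsPredictable θ) {t : ℤ}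
    (ht : t ∈ Finset.Icc (1 : ℤ) T) :
    CondGaussian (M.riskNeutral θ μ) (M.H (t - 1)) (M.y t)
      (fun ω => M.PiAt t ω *ᵥ M.lagged t ω + θ t ω) (M.Sig t) := by
  have := hM.isProbabilityMeasure_riskNeutral hθ
  exact (hM.isStdNormalGiven_epsTilde hθ ht).condGaussian (hM.H_le _)
    ((M.measurable_mean_H ht).add (hθ t ht))
    (hM.measurable_chol_H ht) (fun ω => (hM.cholesky t ht ω).2.2.symm)
    fun ω => hM.y_eq_mean_add ω θ ht

lemma condExp_riskNeutral_ae_eq (hM : M.IsRegimeSwitching μ) (hθ : M.IsPredictable θ)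
    (h𝒢 : 𝒢 ≤ M.H 0) {S : Set Ω} (hS : MeasurableSet[M.H 0] S) :
    (M.riskNeutral θ μ)⟦S | 𝒢⟧ =ᵐ[μ] μ⟦S | 𝒢⟧ := by
  have := hM.isProbabilityMeasure_riskNeutral hθ
  exact condExp_indicator_ae_eq_of_measure_eq h𝒢 (hM.H_le 0)
    (fun A hA => hM.riskNeutral_apply_of_measurableSet_H_zero hθ hA) hS

lemma condExp_regimes_trans_ae_eq (hM : M.IsRegimeSwitching μ) (hθ : M.IsPredictable θ)
    {B : Set ((Times 1 T → Fin N) × Matrix (Fin N) (Fin N) ℝ)} (hB : MeasurableSet B) :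
    (M.riskNeutral θ μ)⟦{ω | (M.sVec ω, M.trans ω) ∈ B} | M.F0⟧ =ᵐ[μ]
      μ⟦{ω | (M.sVec ω, M.trans ω) ∈ B} | M.F0⟧ := by
  have hmeas : Measurable[M.H 0] fun ω => (M.sVec ω, M.trans ω) :=
    (measurable_sVec.mono (M.sigmaRegimes_le_H 0) le_rfl).prodMk
      ((comap_measurable M.trans).mono (M.sigmaTrans_le_H 0) le_rfl)
  exact hM.condExp_riskNeutral_ae_eq hθ (M.F0_le_H 0) (hmeas hB)

lemma condExp_coeff_ae_eq (hM : M.IsRegimeSwitching μ) (hθ : M.IsPredictable θ)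
    {B : Set ((Fin N → Matrix (Fin n) (Cols k p n) ℝ) ×
      (Fin N → Matrix (Fin n') (Cols k' (p' + q') n') ℝ))} (hB : MeasurableSet B) :
    (M.riskNeutral θ μ)⟦{ω | (fun j => M.Pi j ω, fun j => M.Gam j ω) ∈ B} |
        M.F0 ⊔ M.sigmaRegimes T ⊔ M.sigmaTrans⟧ =ᵐ[μ]
      μ⟦{ω | (fun j => M.Pi j ω, fun j => M.Gam j ω) ∈ B} | M.F0 ⊔ M.sigmaRegimes T⟧ := by
  have hmeas : Measurable[M.sigmaCoeff] fun ω => (fun j => M.Pi j ω, fun j => M.Gam j ω) :=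
    (@measurable_pi_lambda _ _ _ M.sigmaCoeff _ _ M.measurable_Pi_sigmaCoeff).prodMk
      (@measurable_pi_lambda _ _ _ M.sigmaCoeff _ _ M.measurable_Gam_sigmaCoeff)
  exact (hM.condExp_riskNeutral_ae_eq hθ M.F0_sup_regimes_sup_trans_le_H
    (M.sigmaCoeff_le_H 0 _ (hmeas hB))).trans (hM.condExp_sigmaCoeff_ae_eq (hmeas hB))

/- Given `s = σ`, the stacked matrices are those of the deterministic regime path `σ`. -/
lemma condExp_coeffAt_ae_eq (hM : M.IsRegimeSwitching μ) (hθ : M.IsPredictable θ)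
    {B : Set ((Times 1 T → Matrix (Fin n) (Cols k p n) ℝ) ×
      (Times 1 T → Matrix (Fin n') (Cols k' (p' + q') n') ℝ))} (hB : MeasurableSet B) :
    (M.riskNeutral θ μ)⟦{ω | (fun t : Times 1 T => M.PiAt t ω,
        fun t : Times 1 T => M.GamAt t ω) ∈ B} |
        M.F0 ⊔ M.sigmaRegimes T ⊔ M.sigmaTrans⟧ =ᵐ[μ]
      μ⟦{ω | (fun t : Times 1 T => M.PiAt t ω, fun t : Times 1 T => M.GamAt t ω) ∈ B} |
        M.F0 ⊔ M.sigmaRegimes T⟧ := by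
  have hle := M.F0_sup_regimes_sup_trans_le_H
  have hpath : ∀ σ : Times 1 T → Fin N, Measurable[M.sigmaCoeff] fun ω =>
      ((fun t : Times 1 T => M.Pi (σ t) ω), (fun t : Times 1 T => M.Gam (σ t) ω)) := fun σ =>
    (@measurable_pi_lambda _ _ _ M.sigmaCoeff _ _
      fun t : Times 1 T => M.measurable_Pi_sigmaCoeff (σ t)).prodMk
      (@measurable_pi_lambda _ _ _ M.sigmaCoeff _ _
        fun t : Times 1 T => M.measurable_Gam_sigmaCoeff (σ t))
  have hmeas : Measurable[M.H 0] fun ω =>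
      ((fun t : Times 1 T => M.PiAt t ω), (fun t : Times 1 T => M.GamAt t ω)) :=
    (@measurable_pi_lambda _ _ _ (M.H 0) _ _
      fun t : Times 1 T => M.measurable_PiAt_H 0 t.2).prodMk
      (@measurable_pi_lambda _ _ _ (M.H 0) _ _
        fun t : Times 1 T => M.measurable_GamAt_H 0 t.2)
  refine (hM.condExp_riskNeutral_ae_eq hθ hle (hmeas hB)).trans ?_
  exact condExp_indicator_mem_ae_eq (s := M.sVec)
    (A := fun σ => {ω | ((fun t : Times 1 T => M.Pi (σ t) ω),
      (fun t : Times 1 T => M.Gam (σ t) ω)) ∈ B}) le_sup_left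
    (hle.trans (hM.H_le 0)) (measurable_sVec.mono le_sup_right le_rfl)
    (fun σ => hM.sigmaCoeff_le _ (hpath σ hB)) fun σ => hM.condExp_sigmaCoeff_ae_eq (hpath σ hB)

end IsRegimeSwitching

end Conclusions

end MSVAR

theorem theorem2_general {Ω : Type*} [MeasurableSpace Ω] (μ : Measure Ω) [IsProbabilityMeasure μ]
    {n k p T N n' k' p' q' Tpast : ℕ} (M : MSVAR Ω n k p T N n' k' p' q' Tpast)
    (hM : M.IsRegimeSwitching μ)
    (θ : ℤ → Ω → Fin n → ℝ) (Δ : ℤ → Ω → Matrix (Fin n) (Cols k p n) ℝ)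
    (hθ : M.IsPredictable θ) (hlin : M.IsLinearInLags θ Δ) :
    IsProbabilityMeasure (M.riskNeutral θ μ) ∧
    (Measurable[M.H 0] (M.Psi Δ 1 T 1 T) → Measurable[M.H 0] (M.delta Δ 1 T) →
      Measurable[M.H 0] (M.SigDiag 1 T) →
      CondGaussian (M.riskNeutral θ μ) (M.H 0) (M.yStack 1 T)
        (fun ω => (M.Psi Δ 1 T 1 T ω)⁻¹ *ᵥ M.delta Δ 1 T ω)
        (fun ω => (M.Psi Δ 1 T 1 T ω)⁻¹ * M.SigDiag 1 T ω * ((M.Psi Δ 1 T 1 T ω)⁻¹)ᵀ)) ∧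
    (∀ t ∈ Finset.Icc (0 : ℤ) T,
      (Measurable[M.H 0] (M.Psi Δ 1 t 1 t) → Measurable[M.H 0] (M.delta Δ 1 t) →
        Measurable[M.H 0] (M.SigDiag 1 t) →
        CondGaussian (M.riskNeutral θ μ) (M.H 0) (M.yStack 1 t)
          (fun ω => (M.Psi Δ 1 t 1 t ω)⁻¹ *ᵥ M.delta Δ 1 t ω)
          (fun ω => (M.Psi Δ 1 t 1 t ω)⁻¹ * M.SigDiag 1 t ω * ((M.Psi Δ 1 t 1 t ω)⁻¹)ᵀ)) ∧
      (Measurable[M.H 0] (M.Psi Δ 1 T 1 T) → Measurable[M.H 0] (M.delta Δ 1 T) →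
        Measurable[M.H 0] (M.SigDiag 1 T) →
        CondGaussian (M.riskNeutral θ μ) (M.H 0) (M.yStack (t + 1) T)
          (fun ω => M.C21 Δ t ω *ᵥ M.delta Δ 1 t ω +
            (M.Psi Δ (t + 1) T (t + 1) T ω)⁻¹ *ᵥ M.delta Δ (t + 1) T ω)
          (fun ω => M.C21 Δ t ω * M.SigDiag 1 t ω * (M.C21 Δ t ω)ᵀ +
            (M.Psi Δ (t + 1) T (t + 1) T ω)⁻¹ * M.SigDiag (t + 1) T ω *
              ((M.Psi Δ (t + 1) T (t + 1) T ω)⁻¹)ᵀ)) ∧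
      (Measurable[M.H t] (M.Psi Δ (t + 1) T 1 t) →
        Measurable[M.H t] (M.Psi Δ (t + 1) T (t + 1) T) →
        Measurable[M.H t] (M.delta Δ (t + 1) T) → Measurable[M.H t] (M.SigDiag (t + 1) T) →
        CondGaussian (M.riskNeutral θ μ) (M.H t) (M.yStack (t + 1) T)
          (fun ω => (M.Psi Δ (t + 1) T (t + 1) T ω)⁻¹ *ᵥ
            (M.delta Δ (t + 1) T ω - M.Psi Δ (t + 1) T 1 t ω *ᵥ M.yStack 1 t ω))
          (fun ω => (M.Psi Δ (t + 1) T (t + 1) T ω)⁻¹ * M.SigDiag (t + 1) T ω *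
            ((M.Psi Δ (t + 1) T (t + 1) T ω)⁻¹)ᵀ))) ∧
    (∀ t ∈ Finset.Icc (1 : ℤ) T,
      CondGaussian (M.riskNeutral θ μ) (M.H (t - 1)) (M.y t)
        (fun ω => M.PiAt t ω *ᵥ M.lagged t ω + θ t ω) (M.Sig t)) ∧
    (∀ B : Set ((Times 1 T → Fin N) × Matrix (Fin N) (Fin N) ℝ), MeasurableSet B →
      (M.riskNeutral θ μ)⟦{ω | (M.sVec ω, M.trans ω) ∈ B} | M.F0⟧ =ᵐ[μ]
        μ⟦{ω | (M.sVec ω, M.trans ω) ∈ B} | M.F0⟧) ∧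
    (∀ B : Set ((Fin N → Matrix (Fin n) (Cols k p n) ℝ) ×
        (Fin N → Matrix (Fin n') (Cols k' (p' + q') n') ℝ)), MeasurableSet B →
      (M.riskNeutral θ μ)⟦{ω | (fun j => M.Pi j ω, fun j => M.Gam j ω) ∈ B} |
          M.F0 ⊔ M.sigmaRegimes T ⊔ M.sigmaTrans⟧ =ᵐ[μ]
        μ⟦{ω | (fun j => M.Pi j ω, fun j => M.Gam j ω) ∈ B} | M.F0 ⊔ M.sigmaRegimes T⟧) ∧
    (∀ B : Set ((Times 1 T → Matrix (Fin n) (Cols k p n) ℝ) ×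
        (Times 1 T → Matrix (Fin n') (Cols k' (p' + q') n') ℝ)), MeasurableSet B →
      (M.riskNeutral θ μ)⟦{ω | (fun t : Times 1 T => M.PiAt t ω,
          fun t : Times 1 T => M.GamAt t ω) ∈ B} | M.F0 ⊔ M.sigmaRegimes T ⊔ M.sigmaTrans⟧ =ᵐ[μ]
        μ⟦{ω | (fun t : Times 1 T => M.PiAt t ω, fun t : Times 1 T => M.GamAt t ω) ∈ B} |
          M.F0 ⊔ M.sigmaRegimes T⟧) := by
  have htop : (T : ℤ) ∈ Finset.Icc (0 : ℤ) T := Finset.mem_Icc.2 ⟨by omega, le_rfl⟩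
  exact ⟨hM.isProbabilityMeasure_riskNeutral hθ,
    hM.condGaussian_past hθ hlin htop,
    fun t ht => ⟨hM.condGaussian_past hθ hlin ht, hM.condGaussian_future_initial hθ hlin ht,
      hM.condGaussian_future hθ hlin ht⟩,
    fun t ht => hM.condGaussian_step hθ ht,
    fun B hB => hM.condExp_regimes_trans_ae_eq hθ hB,
    fun B hB => hM.condExp_coeff_ae_eq hθ hB,
    fun B hB => hM.condExp_coeffAt_ae_eq hθ hB⟩

theorem theorem2 {Ω : Type*} [MeasurableSpace Ω] (μ : Measure Ω) [IsProbabilityMeasure μ]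
    {n k p T N n' k' p' q' Tpast : ℕ} (M : MSVAR Ω n k p T N n' k' p' q' Tpast)
    (hM : M.IsModel μ)
    (θ : ℤ → Ω → Fin n → ℝ) (Δ : ℤ → Ω → Matrix (Fin n) (Cols k p n) ℝ)
    (hθ : M.IsLinearKernel θ Δ) :
    IsProbabilityMeasure (M.riskNeutral θ μ) ∧
    -- law of `y` given `𝓗_0`
    (Measurable[M.H 0] (M.Psi Δ 1 T 1 T) → Measurable[M.H 0] (M.delta Δ 1 T) →
      Measurable[M.H 0] (M.SigDiag 1 T) →
      CondGaussian (M.riskNeutral θ μ) (M.H 0) (M.yStack 1 T)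
        (fun ω => (M.Psi Δ 1 T 1 T ω)⁻¹ *ᵥ M.delta Δ 1 T ω)
        (fun ω => (M.Psi Δ 1 T 1 T ω)⁻¹ * M.SigDiag 1 T ω * ((M.Psi Δ 1 T 1 T ω)⁻¹)ᵀ)) ∧
    (∀ t ∈ Finset.Icc (0 : ℤ) T,
      -- law of the past block given `𝓗_0`
      (Measurable[M.H 0] (M.Psi Δ 1 t 1 t) → Measurable[M.H 0] (M.delta Δ 1 t) →
        Measurable[M.H 0] (M.SigDiag 1 t) →
        CondGaussian (M.riskNeutral θ μ) (M.H 0) (M.yStack 1 t)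
          (fun ω => (M.Psi Δ 1 t 1 t ω)⁻¹ *ᵥ M.delta Δ 1 t ω)
          (fun ω => (M.Psi Δ 1 t 1 t ω)⁻¹ * M.SigDiag 1 t ω * ((M.Psi Δ 1 t 1 t ω)⁻¹)ᵀ)) ∧
      -- law of the future block given `𝓗_0`
      (Measurable[M.H 0] (M.Psi Δ 1 T 1 T) → Measurable[M.H 0] (M.delta Δ 1 T) →
        Measurable[M.H 0] (M.SigDiag 1 T) →
        CondGaussian (M.riskNeutral θ μ) (M.H 0) (M.yStack (t + 1) T)
          (fun ω => M.C21 Δ t ω *ᵥ M.delta Δ 1 t ω +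
            (M.Psi Δ (t + 1) T (t + 1) T ω)⁻¹ *ᵥ M.delta Δ (t + 1) T ω)
          (fun ω => M.C21 Δ t ω * M.SigDiag 1 t ω * (M.C21 Δ t ω)ᵀ +
            (M.Psi Δ (t + 1) T (t + 1) T ω)⁻¹ * M.SigDiag (t + 1) T ω *
              ((M.Psi Δ (t + 1) T (t + 1) T ω)⁻¹)ᵀ)) ∧
      -- law of the future block given `𝓗_t`
      (Measurable[M.H t] (M.Psi Δ (t + 1) T 1 t) →
        Measurable[M.H t] (M.Psi Δ (t + 1) T (t + 1) T) →
        Measurable[M.H t] (M.delta Δ (t + 1) T) → Measurable[M.H t] (M.SigDiag (t + 1) T) →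
        CondGaussian (M.riskNeutral θ μ) (M.H t) (M.yStack (t + 1) T)
          (fun ω => (M.Psi Δ (t + 1) T (t + 1) T ω)⁻¹ *ᵥ
            (M.delta Δ (t + 1) T ω - M.Psi Δ (t + 1) T 1 t ω *ᵥ M.yStack 1 t ω))
          (fun ω => (M.Psi Δ (t + 1) T (t + 1) T ω)⁻¹ * M.SigDiag (t + 1) T ω *
            ((M.Psi Δ (t + 1) T (t + 1) T ω)⁻¹)ᵀ))) ∧
    -- one-step law
    (∀ t ∈ Finset.Icc (1 : ℤ) T,
      CondGaussian (M.riskNeutral θ μ) (M.H (t - 1)) (M.y t)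
        (fun ω => M.PiAt t ω *ᵥ M.lagged t ω + θ t ω) (M.Sig t)) ∧
    -- posterior law of `(s, P)` given `𝓕_0`
    (∀ B : Set ((Times 1 T → Fin N) × Matrix (Fin N) (Fin N) ℝ), MeasurableSet B →
      (M.riskNeutral θ μ)⟦{ω | (M.sVec ω, M.trans ω) ∈ B} | M.F0⟧ =ᵐ[μ]
        μ⟦{ω | (M.sVec ω, M.trans ω) ∈ B} | M.F0⟧) ∧
    -- law of `(Π, Γ)`, as the coefficient matrices of all regimes
    (∀ B : Set ((Fin N → Matrix (Fin n) (Cols k p n) ℝ) ×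
        (Fin N → Matrix (Fin n') (Cols k' (p' + q') n') ℝ)), MeasurableSet B →
      (M.riskNeutral θ μ)⟦{ω | (fun j => M.Pi j ω, fun j => M.Gam j ω) ∈ B} |
          M.F0 ⊔ M.sigmaRegimes T ⊔ M.sigmaTrans⟧ =ᵐ[μ]
        μ⟦{ω | (fun j => M.Pi j ω, fun j => M.Gam j ω) ∈ B} | M.F0 ⊔ M.sigmaRegimes T⟧) ∧
    -- law of `(Π, Γ)`, as the stacked matrices `[Π_1 : ⋯ : Π_T]` and `[Γ_1 : ⋯ : Γ_T]`
    (∀ B : Set ((Times 1 T → Matrix (Fin n) (Cols k p n) ℝ) ×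
        (Times 1 T → Matrix (Fin n') (Cols k' (p' + q') n') ℝ)), MeasurableSet B →
      (M.riskNeutral θ μ)⟦{ω | (fun t : Times 1 T => M.PiAt t ω, fun t : Times 1 T => M.GamAt t ω) ∈ B} |
          M.F0 ⊔ M.sigmaRegimes T ⊔ M.sigmaTrans⟧ =ᵐ[μ]
        μ⟦{ω | (fun t : Times 1 T => M.PiAt t ω, fun t : Times 1 T => M.GamAt t ω) ∈ B} |
          M.F0 ⊔ M.sigmaRegimes T⟧) := by
  exact theorem2_general μ M hM.isRegimeSwitching θ Δ hθ.isPredictable hθ.isLinearInLags
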